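/- \textbf{Theorem.} Let $M$ be a smooth finite-dimensional manifold (Hausdorff, second countable, without boundary), let $g$ be a complete smooth Riemannian metric on $M$, and let $\omega$ be a smooth closed 1-form on $M$. Notation. For a Riemannian metric $g$, $\mathrm{grad}_g(\omega)$ is the vector field with $g(\mathrm{grad}_g(\omega),v)=\omega(v)$ for all tangent vectors $v$, and the gradient flow of $\omega$ with respect to $g$ is the flow of $-\mathrm{grad}_g(\omega)$. The number $\mathrm{cat}(M,\omega)\in\{0,1,2,\dots\}\cup\{\infty\}$ is the smallest integer $k\ge 0$ such that for every positive integer $N$ there is an open cover $M=U\cup U_1\cup\dots\cup U_k$ in which each $U_i$ is null-homotopic in $M$, together with a smooth homotopy $h:U\times[0,1]\to M$ for which $h_0$ is the inclusion and $\int_{\gamma_x}\omega\le -N$ for every $x\in U$, where $\gamma_x(t)=h_t(x)$; it is $\infty$ if no such $k$ exists. A homoclinic cycle of a flow is a finite family $\gamma_1,\dots,\gamma_m$ ($m\ge 1$) of non-constant trajectories, defined for all times, which converge to rest points as $t\to\pm\infty$ and satisfy $\lim_{t\to\infty}\gamma_i(t)=\lim_{t\to-\infty}\gamma_{i+1}(t)$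 for $1\le i\le m-1$ and $\lim_{t\to\infty}\gamma_m(t)=\lim_{t\to-\infty}\gamma_1(t)$. Suppose that \begin{itemize} \item the number of zeros of $\omega$ is less than $\mathrm{cat}(M,\omega)$; \item $\mathrm{grad}_g(\omega)$ is a complete vector field, and there are $c>0$ and a relatively compact neighborhood $U$ of the set of zeros of $\omega$ such that $|\mathrm{grad}_g(\omega)|_g\ge c$ on $M\setminus U$. \end{itemize} Then the gradient flow of $\omega$ with respect to $g$ has a homoclinic cycle. Furthermore, let $g'$ be a complete smooth Riemannian metric on $M$ such that $\mathrm{grad}_{g'}(\omega)$ is a complete vector field and \[ \frac{g}{C}\le g'\le C g \] for some $C\ge 1$. Then $|\mathrm{grad}_{g'}(\omega)|_{g'}\ge c/C$ on $M\setminus U$, and the gradient flow of $\omega$ with respect to $g'$ also has a homoclinic cycle. -/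

import Mathlib

open Set Filter Topology Bundle
open scoped Manifold ContDiff ENNReal

noncomputable section

namespace Homoclinic

variable {E : Type*} [NormedAddCommGroup E] [NormedSpace ℝ E]
  {M : Type*} [TopologicalSpace M] [ChartedSpace E M]

/-- The expression of a 1-form `η` (a family of covectors) in the preferred chart `φ` at `x₀`: the
pullback of `η` by `φ⁻¹`, a field of covectors on the (open) image of the chart in `E`. -/
def localRep (η : (x : M) → TangentSpace 𝓘(ℝ, E) x →L[ℝ] ℝ) (x₀ : M) (y : E) : E →L[ℝ] ℝ :=
  (η ((extChartAt 𝓘(ℝ, E) x₀).symm y)).comp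
    (mfderiv 𝓘(ℝ, E) 𝓘(ℝ, E) (extChartAt 𝓘(ℝ, E) x₀).symm y)

variable (E M) in
/-- Smooth closed 1-forms on `M`. Closedness is `dη = 0`, where in a chart
`dη(u, v) = D_u η(v) - D_v η(u)`. -/
structure ClosedOneForm [IsManifold 𝓘(ℝ, E) ∞ M] where
  /-- The covector at each point. -/
  toFun (x : M) : TangentSpace 𝓘(ℝ, E) x →L[ℝ] ℝ
  /-- `η` is a smooth section of the cotangent bundle. -/
  smooth : ContMDiff 𝓘(ℝ, E) (𝓘(ℝ, E).prod 𝓘(ℝ, E →L[ℝ] ℝ)) ∞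
    (fun x ↦ TotalSpace.mk' (E →L[ℝ] ℝ)
      (E := fun x : M ↦ TangentSpace 𝓘(ℝ, E) x →L[ℝ] ℝ) x (toFun x))
  /-- `dη = 0` in every preferred chart. -/
  closed (x₀ : M) (y : E) (hy : y ∈ (extChartAt 𝓘(ℝ, E) x₀).target) (u v : E) :
    fderiv ℝ (localRep toFun x₀) y u v = fderiv ℝ (localRep toFun x₀) y v u

variable (E M) in
/-- Smooth Riemannian metrics on `M`. -/
abbrev Metric [IsManifold 𝓘(ℝ, E) ∞ M] :=
  ContMDiffRiemannianMetric 𝓘(ℝ, E) ∞ E (fun x : M ↦ TangentSpace 𝓘(ℝ, E) x)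

variable [IsManifold 𝓘(ℝ, E) ∞ M]

/-- The set of zeros of a closed 1-form. -/
def ClosedOneForm.zeros (η : ClosedOneForm E M) : Set M := {x | η.toFun x = 0}

/-- The integral `∫_γ η` over a path `γ`, which is only looked at on `[0, 1]`. -/
def ClosedOneForm.integral (η : ClosedOneForm E M) (γ : ℝ → M) : ℝ :=
  ∫ t in (0 : ℝ)..1, η.toFun (γ t) (mfderivWithin 𝓘(ℝ, ℝ) 𝓘(ℝ, E) γ (Icc 0 1) t (1 : ℝ))

/-- For the integer `N` there is an open cover `M = U ∪ U₁ ∪ ⋯ ∪ U_k` such that every `U_i` is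
null-homotopic in `M`, and such that there is a smooth homotopy `h : U × [0, 1] → M` starting at
the inclusion, with `∫ η ≤ -N` along the path `t ↦ h x t` for each `x ∈ U`. -/
def ClosedOneForm.HasCover (η : ClosedOneForm E M) (k N : ℕ) : Prop :=
  ∃ (U : Set M) (V : Fin k → Set M),
    IsOpen U ∧ (∀ i, IsOpen (V i)) ∧ U ∪ (⋃ i, V i) = univ ∧
    (∀ i, (ContinuousMap.mk (Subtype.val : V i → M) continuous_subtype_val).Nullhomotopic) ∧
    ∃ h : M → ℝ → M,
      ContMDiffOn (𝓘(ℝ, E).prod 𝓘(ℝ, ℝ)) 𝓘(ℝ, E) ∞ (fun p : M × ℝ ↦ h p.1 p.2)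
        (U ×ˢ Icc (0 : ℝ) 1) ∧
      (∀ x ∈ U, h x 0 = x) ∧
      ∀ x ∈ U, η.integral (h x) ≤ -(N : ℝ)

/-- The category `cat(M, η)`: the least `k` such that for every positive integer `N` there is a
cover as in `HasCover`; it is `⊤` if there is no such `k`. -/
def ClosedOneForm.cat (η : ClosedOneForm E M) : ℕ∞ :=
  ⨅ (k : ℕ) (_ : ∀ N : ℕ, 0 < N → η.HasCover k N), (k : ℕ∞)

/-- The length `|v|_g` of a tangent vector. -/
def Metric.norm (g : Metric E M) {x : M} (v : TangentSpace 𝓘(ℝ, E) x) : ℝ :=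
  Real.sqrt (g.inner x v v)

/-- The Riemannian distance of `g`: the infimum of the lengths of `C¹` paths. -/
def Metric.edist (g : Metric E M) (x y : M) : ℝ≥0∞ :=
  letI : RiemannianBundle (fun x : M ↦ TangentSpace 𝓘(ℝ, E) x) := ⟨g.toRiemannianMetric⟩
  Manifold.riemannianEDist 𝓘(ℝ, E) x y

/-- `g` is a complete metric: Cauchy sequences for its Riemannian distance converge. -/
def Metric.IsComplete (g : Metric E M) : Prop :=
  ∀ u : ℕ → M,
    (∀ ε : ℝ≥0∞, 0 < ε → ∃ n₀, ∀ m ≥ n₀, ∀ n ≥ n₀, Metric.edist g (u m) (u n) < ε) →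
    ∃ x, Tendsto (fun n ↦ Metric.edist g (u n) x) atTop (𝓝 0)

theorem exists_gradient [FiniteDimensional ℝ E] (g : Metric E M) (η : ClosedOneForm E M) (x : M) :
    ∃! v : TangentSpace 𝓘(ℝ, E) x, ∀ w, g.inner x v w = η.toFun x w := by
  let B : E →ₗ[ℝ] (E →L[ℝ] ℝ) := (g.inner x : E →L[ℝ] E →L[ℝ] ℝ).toLinearMap
  have hinj : Function.Injective B := by
    rw [injective_iff_map_eq_zero]
    intro v hv
    by_contra hne
    have h1 := g.pos x v hne
    have h2 : B v v = 0 := by rw [hv]; rfl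
    exact h1.ne' h2
  have hdim : Module.finrank ℝ E = Module.finrank ℝ (E →L[ℝ] ℝ) := by
    rw [← (LinearMap.toContinuousLinearMap (𝕜 := ℝ) (E := E) (F' := ℝ)).finrank_eq]
    exact (Subspace.dual_finrank_eq (K := ℝ) (V := E)).symm
  have hsurj : Function.Surjective B :=
    (LinearMap.injective_iff_surjective_of_finrank_eq_finrank hdim).1 hinj
  obtain ⟨v, hv⟩ := hsurj (η.toFun x)
  refine ⟨v, fun w ↦ DFunLike.congr_fun hv w, fun v' hv' ↦ hinj ?_⟩
  rw [hv]
  exact ContinuousLinearMap.ext hv'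

/-- The gradient of `η` with respect to `g`: the vector field with `g(grad η, w) = η(w)`. -/
def grad [FiniteDimensional ℝ E] (g : Metric E M) (η : ClosedOneForm E M) (x : M) :
    TangentSpace 𝓘(ℝ, E) x :=
  (exists_gradient g η x).choose

theorem inner_grad [FiniteDimensional ℝ E] (g : Metric E M) (η : ClosedOneForm E M) (x : M)
    (w : TangentSpace 𝓘(ℝ, E) x) : g.inner x (grad g η x) w = η.toFun x w :=
  (exists_gradient g η x).choose_spec.1 w

/-- A vector field is complete if through each point there is an integral curve defined for all
times. -/
def IsCompleteField (X : (x : M) → TangentSpace 𝓘(ℝ, E) x) : Prop :=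
  ∀ x : M, ∃ γ : ℝ → M, γ 0 = x ∧ IsMIntegralCurve γ X

/-- The flow of the vector field `X` has a homoclinic cycle: finitely many (at least one)
non-constant trajectories `γ₀, …, γ_m` connecting rest points, such that `γ_i` tends to `p_i` as
`t → -∞` and to `p_{i+1}` as `t → +∞`, with indices modulo `m + 1`. -/
def HasHomoclinicCycle (X : (x : M) → TangentSpace 𝓘(ℝ, E) x) : Prop :=
  ∃ (m : ℕ) (p : Fin (m + 1) → M) (γ : Fin (m + 1) → ℝ → M),
    (∀ i, X (p i) = 0) ∧
    ∀ i, IsMIntegralCurve (γ i) X ∧ (∃ s t, γ i s ≠ γ i t) ∧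
      Tendsto (γ i) atBot (𝓝 (p i)) ∧ Tendsto (γ i) atTop (𝓝 (p (i + 1)))

/-- The gradient flow of `η` with respect to `g`, that is the flow of `-grad η`, has a homoclinic
cycle. -/
def GradientFlowHasHomoclinicCycle [FiniteDimensional ℝ E] (g : Metric E M)
    (η : ClosedOneForm E M) : Prop :=
  HasHomoclinicCycle (fun x ↦ -grad g η x)

end Homoclinic

end

/-!
Suppose that the gradient flow `φ` of `-grad η` has no homoclinic cycle, and let `η` have `k` zeros.
For every `N` a cover as in `ClosedOneForm.HasCover` with `k` null-homotopic sets is constructed, so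
that `cat(M, η) ≤ k`, contrary to the hypothesis.

Write `q = |grad η|²` and `drop x t = ∫₀ᵗ q(φ_s x) ds`; this is minus the integral of `η` along the
trajectory of `x` up to time `t`. A trajectory with bounded drop spends a finite time outside the
compact set `closure U`, since `q ≥ c²` there. Hence it returns to this set for arbitrarily large
times, its limit points are zeros by LaSalle's principle, and it converges to a zero because there
are finitely many (`IsDissipative.exists_tendsto_atTop`). The first set of the cover consists of the
points from which `η` drops by more than `N`; the homotopy flows each `x` for a time `τ x` at which
this has happened, chosen smoothly by a partition of unity (`exists_contMDiffOn_time`). The other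
points flow into one of the zeros, and `U_p` consists of the points which meet a small neighborhood
`B p` of the zero `p` before dropping by `N + 1`.

To contract `U_p`, flow each of its points for a time between two visits to `B p`, again chosen
continuously. For this to end in a prescribed chart ball around `p`, a piece of trajectory with drop
at most `N + 1` and with ends in `B p` must not leave the ball. This is where the absence of cycles
enters (`IsDissipative.exists_nhds_no_return`). Otherwise there are such pieces which start and end
ever closer to `p` and leave the ball; their first exit points accumulate at a point whose
trajectory leads from `p` to some zero `p₂` (`IsDissipative.heteroclinic_of_escapes`). If `p₂ ≠ p`,
the pieces pass by `p₂` and go on to `p`, and the argument is repeated at `p₂`. As the relation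
"there is a chain of trajectories from `p` to `p'`" has no cycles on a finite set, it is
well-founded, so this terminates with a chain from `p` to itself, a contradiction.

The homotopy has to be smooth, so the flow must be smooth jointly in the point and in time. The
local statement is `exists_contDiffAt_local_flow`, by induction on the order of differentiability
through the variational equation; `IsFlowOf.contMDiff` extends it to all times by the group law.

For the metric `g'`, the Cauchy–Schwarz inequality gives the lower bound for the length of its
gradient (`le_norm_grad_of_le`), and the same argument applies.
-/

noncomputable section

namespace Homoclinic

/-! ### Smooth dependence of local flows on the initial condition -/

section ODE

universe u

variable {E : Type u} [NormedAddCommGroup E] [NormedSpace ℝ E]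

/-- Quantitative linearization of a flow: if `a` and `b` solve `y' = v y` and `A` solves the
variational equation along `a`, then `b T - a T` agrees with `A T (b 0 - a 0)` up to a quadratic
error, by Grönwall's inequality for `b - a - A (b 0 - a 0)`. -/
theorem norm_sub_sub_variational_le {v : E → E} {S : Set E} (hS : Convex ℝ S) {K : NNReal} {L : ℝ}
    (hK0 : 0 < K) (hL0 : 0 ≤ L) (hd : ∀ x ∈ S, DifferentiableAt ℝ v x)
    (hK : ∀ x ∈ S, ‖fderiv ℝ v x‖ ≤ K)
    (hL : ∀ x ∈ S, ∀ y ∈ S, ‖fderiv ℝ v x - fderiv ℝ v y‖ ≤ L * ‖x - y‖)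
    {T : ℝ} (hT : 0 ≤ T) {a b : ℝ → E} {A : ℝ → E →L[ℝ] E}
    (ha : ∀ t ∈ Icc 0 T, a t ∈ S ∧ HasDerivAt a (v (a t)) t)
    (hb : ∀ t ∈ Icc 0 T, b t ∈ S ∧ HasDerivAt b (v (b t)) t)
    (hA : ∀ t ∈ Icc 0 T, HasDerivAt A ((fderiv ℝ v (a t)).comp (A t)) t)
    (hA0 : A 0 = ContinuousLinearMap.id ℝ E) :
    ‖b T - a T - A T (b 0 - a 0)‖ ≤
      L * Real.exp (K * T) ^ 2 / K * (Real.exp (K * T) - 1) * ‖b 0 - a 0‖ ^ 2 := by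
  set h := b 0 - a 0 with hh
  have hlip : LipschitzOnWith K v S :=
    hS.lipschitzOnWith_of_nnnorm_fderiv_le hd fun x hx ↦ hK x hx
  have hcont : ∀ {c : ℝ → E}, (∀ t ∈ Icc 0 T, c t ∈ S ∧ HasDerivAt c (v (c t)) t) →
      ContinuousOn c (Icc 0 T) := fun hc t ht ↦ (hc t ht).2.continuousAt.continuousWithinAt
  have hdist : ∀ t ∈ Icc 0 T, ‖b t - a t‖ ≤ ‖h‖ * Real.exp (K * T) := by
    intro t ht
    have := dist_le_of_trajectories_ODE_of_mem (v := fun _ ↦ v) (s := fun _ ↦ S) (K := K)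
      (δ := ‖h‖) (fun _ _ ↦ hlip) (hcont hb)
      (fun t ht ↦ (hb t (Ico_subset_Icc_self ht)).2.hasDerivWithinAt)
      (fun t ht ↦ (hb t (Ico_subset_Icc_self ht)).1) (hcont ha)
      (fun t ht ↦ (ha t (Ico_subset_Icc_self ht)).2.hasDerivWithinAt)
      (fun t ht ↦ (ha t (Ico_subset_Icc_self ht)).1) (by rw [dist_eq_norm]) t ht
    rw [dist_eq_norm] at this
    refine this.trans ?_
    gcongr
    linarith [ht.2]
  have hder : ∀ t ∈ Icc 0 T, HasDerivAt (fun t ↦ b t - a t - A t h)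
      (v (b t) - v (a t) - fderiv ℝ v (a t) (A t h)) t := fun t ht ↦ by
    have := ((hb t ht).2.sub (ha t ht).2).sub ((hA t ht).clm_apply (hasDerivAt_const t h))
    simpa using! this
  have key := norm_le_gronwallBound_of_norm_deriv_right_le (a := 0) (b := T) (δ := 0) (K := K)
    (ε := L * (‖h‖ * Real.exp (K * T)) ^ 2)
    (fun t ht ↦ (hder t ht).continuousAt.continuousWithinAt)
    (fun t ht ↦ (hder t (Ico_subset_Icc_self ht)).hasDerivWithinAt) (by simp [hA0, hh])
    (fun t ht ↦ ?_) T ⟨hT, le_rfl⟩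
  · rw [gronwallBound_of_K_ne_0 (by exact_mod_cast hK0.ne')] at key
    refine key.trans (le_of_eq ?_)
    simp
    ring
  · have ht' := Ico_subset_Icc_self ht
    have hseg : segment ℝ (a t) (b t) ⊆ S := hS.segment_subset (ha t ht').1 (hb t ht').1
    have h1 : ‖v (b t) - v (a t) - fderiv ℝ v (a t) (b t - a t)‖ ≤
        L * ‖b t - a t‖ * ‖b t - a t‖ := by
      refine (convex_segment (a t) (b t)).norm_image_sub_le_of_norm_fderiv_le'
        (fun x hx ↦ hd x (hseg hx)) (fun x hx ↦ ?_) (left_mem_segment ..) (right_mem_segment ..)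
      refine (hL x (hseg hx) _ (ha t ht').1).trans ?_
      gcongr
      exact norm_sub_le_of_mem_segment hx
    have h2 : v (b t) - v (a t) - fderiv ℝ v (a t) (A t h) =
        fderiv ℝ v (a t) (b t - a t - A t h) +
          (v (b t) - v (a t) - fderiv ℝ v (a t) (b t - a t)) := by
      simp only [map_sub]; abel
    rw [h2]
    refine (norm_add_le _ _).trans (add_le_add ?_ (h1.trans ?_))
    · exact ((fderiv ℝ v (a t)).le_opNorm _).trans (by gcongr; exact hK _ (ha t ht').1)
    · rw [mul_assoc, ← sq]
      gcongr
      exact hdist t ht'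

/-- The spatial derivative of a local flow is the solution of the variational equation. -/
theorem hasFDerivAt_flow_of_forward {v : E → E} {S : Set E} (hS : Convex ℝ S) {K : NNReal} {L : ℝ}
    (hK0 : 0 < K) (hL0 : 0 ≤ L) (hd : ∀ x ∈ S, DifferentiableAt ℝ v x)
    (hK : ∀ x ∈ S, ‖fderiv ℝ v x‖ ≤ K)
    (hL : ∀ x ∈ S, ∀ y ∈ S, ‖fderiv ℝ v x - fderiv ℝ v y‖ ≤ L * ‖x - y‖)
    {T : ℝ} (hT : 0 ≤ T) {x : E} {α : E → ℝ → E} {A : ℝ → E →L[ℝ] E}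
    (hα : ∀ᶠ y in 𝓝 x, α y 0 = y ∧ ∀ t ∈ Icc 0 T, α y t ∈ S ∧ HasDerivAt (α y) (v (α y t)) t)
    (hA : ∀ t ∈ Icc 0 T, HasDerivAt A ((fderiv ℝ v (α x t)).comp (A t)) t)
    (hA0 : A 0 = ContinuousLinearMap.id ℝ E) :
    HasFDerivAt (fun y ↦ α y T) (A T) x := by
  rw [hasFDerivAt_iff_isLittleO]
  have hx := hα.self_of_nhds
  refine Asymptotics.IsBigO.trans_isLittleO (g := fun y ↦ ‖y - x‖ ^ 2) ?_ ?_
  · refine Asymptotics.IsBigO.of_bound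
      (L * Real.exp (K * T) ^ 2 / K * (Real.exp (K * T) - 1)) ?_
    filter_upwards [hα] with y hy
    have := norm_sub_sub_variational_le hS hK0 hL0 hd hK hL hT hx.2 hy.2 hA hA0
    rw [hy.1, hx.1] at this
    simpa using this
  · have h1 : (fun y ↦ ‖y - x‖) =o[𝓝 x] (fun _ ↦ (1 : ℝ)) := by
      rw [Asymptotics.isLittleO_one_iff]
      have : ContinuousAt (fun y ↦ ‖y - x‖) x := by fun_prop
      simpa [ContinuousAt] using this
    have h2 := h1.mul_isBigO (Asymptotics.isBigO_refl (fun y ↦ ‖y - x‖) (𝓝 x))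
    simp only [one_mul, ← sq] at h2
    exact h2.trans_isBigO (Asymptotics.isBigO_norm_left.2 (Asymptotics.isBigO_refl _ _))

/-- The version of `hasFDerivAt_flow_of_forward` for times of both signs. -/
theorem hasFDerivAt_flow {v : E → E} {S : Set E} (hS : Convex ℝ S) {K : NNReal} {L : ℝ}
    (hK0 : 0 < K) (hL0 : 0 ≤ L) (hd : ∀ x ∈ S, DifferentiableAt ℝ v x)
    (hK : ∀ x ∈ S, ‖fderiv ℝ v x‖ ≤ K)
    (hL : ∀ x ∈ S, ∀ y ∈ S, ‖fderiv ℝ v x - fderiv ℝ v y‖ ≤ L * ‖x - y‖)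
    {ε T : ℝ} (hT : |T| < ε) {x : E} {α : E → ℝ → E} {A : ℝ → E →L[ℝ] E}
    (hα : ∀ᶠ y in 𝓝 x, α y 0 = y ∧ ∀ t, |t| < ε → α y t ∈ S ∧ HasDerivAt (α y) (v (α y t)) t)
    (hA : ∀ t, |t| < ε → HasDerivAt A ((fderiv ℝ v (α x t)).comp (A t)) t)
    (hA0 : A 0 = ContinuousLinearMap.id ℝ E) :
    HasFDerivAt (fun y ↦ α y T) (A T) x := by
  rcases le_total 0 T with h | h
  · have hmem : ∀ t ∈ Icc 0 T, |t| < ε := fun t ht ↦ by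
      rw [abs_of_nonneg ht.1]; exact ht.2.trans_lt ((le_abs_self T).trans_lt hT)
    exact hasFDerivAt_flow_of_forward hS hK0 hL0 hd hK hL h
      (hα.mono fun y hy ↦ ⟨hy.1, fun t ht ↦ hy.2 t (hmem t ht)⟩) (fun t ht ↦ hA t (hmem t ht)) hA0
  · -- Reverse time: `t ↦ α y (-t)` solves the equation of `-v`.
    have hmem : ∀ t ∈ Icc 0 (-T), |-t| < ε := fun t ht ↦ by
      rw [abs_neg, abs_of_nonneg ht.1]; exact ht.2.trans_lt ((neg_le_abs T).trans_lt hT)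
    have hneg : ∀ z, fderiv ℝ (fun z ↦ -v z) z = -fderiv ℝ v z := fun z ↦ fderiv_fun_neg
    have := hasFDerivAt_flow_of_forward (v := fun z ↦ -v z) (α := fun y t ↦ α y (-t))
      (A := fun t ↦ A (-t)) hS hK0 hL0 (fun z hz ↦ (hd z hz).neg)
      (fun z hz ↦ by rw [hneg, norm_neg]; exact hK z hz)
      (fun z hz w hw ↦ by
        rw [hneg, hneg, neg_sub_neg, norm_sub_rev]; exact hL z hz w hw)
      (neg_nonneg.2 h) (x := x)
      (hα.mono fun y hy ↦ ⟨by simpa using hy.1, fun t ht ↦ ⟨(hy.2 _ (hmem t ht)).1, by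
        simpa using! ((hy.2 _ (hmem t ht)).2).scomp t (hasDerivAt_neg t)⟩⟩)
      (fun t ht ↦ by
        have := (hA _ (hmem t ht)).scomp t (hasDerivAt_neg t)
        simpa [hneg] using! this) (by simpa using hA0)
    simpa using this

/-- A vector field of class `C^(n+1)` near `x₀` on a Banach space has a local flow of class `C^n`,
jointly in the initial condition and time. The induction on `n` applies the statement to the field
`(x, A) ↦ (v x, Dv(x) ∘ A)`, whose flow carries the spatial derivative of the flow of `v`. -/
theorem exists_contDiffAt_local_flow (n : ℕ) : ∀ {E : Type u} [NormedAddCommGroup E]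
    [NormedSpace ℝ E] [CompleteSpace E] {v : E → E} {x₀ : E}, ContDiffAt ℝ (n + 1) v x₀ →
    ∃ α : E × ℝ → E, ContDiffAt ℝ n α (x₀, 0) ∧
      (∀ᶠ p in 𝓝 (x₀, (0 : ℝ)), HasDerivAt (fun t ↦ α (p.1, t)) (v (α p)) p.2) ∧
      ∀ᶠ x in 𝓝 x₀, α (x, 0) = x := by
  induction n with
  | zero =>
    intro E _ _ _ v x₀ hv
    obtain ⟨ε, hε, a, r, L, K, hr, hpl⟩ :=
      IsPicardLindelof.of_contDiffAt_one (f := v) (x₀ := x₀) (by simpa using hv)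
    obtain ⟨α, hα, hcont⟩ :=
      (hpl 0).exists_forall_mem_closedBall_eq_hasDerivWithinAt_continuousOn
    simp only [zero_sub, zero_add] at hα hcont
    have hr' : (0 : ℝ) < r := hr
    have hnhds : Metric.closedBall x₀ r ×ˢ Icc (-ε) ε ∈ 𝓝 (x₀, (0 : ℝ)) :=
      prod_mem_nhds (Metric.closedBall_mem_nhds _ hr') (Icc_mem_nhds (by linarith) hε)
    refine ⟨α, ?_, ?_, ?_⟩
    · simp only [Nat.cast_zero]
      exact contDiffAt_zero.2 ⟨_, hnhds, hcont⟩
    · have hnhds' : Metric.closedBall x₀ r ×ˢ Ioo (-ε) ε ∈ 𝓝 (x₀, (0 : ℝ)) :=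
        prod_mem_nhds (Metric.closedBall_mem_nhds _ hr') (Ioo_mem_nhds (by linarith) hε)
      filter_upwards [hnhds'] with p hp
      exact ((hα p.1 hp.1).2 p.2 (Ioo_subset_Icc_self hp.2)).hasDerivAt
        (Icc_mem_nhds hp.2.1 hp.2.2)
    · filter_upwards [Metric.closedBall_mem_nhds x₀ hr'] with x hx using (hα x hx).1
  | succ n ih =>
    intro E _ _ _ v x₀ hv
    let w : E × (E →L[ℝ] E) → E × (E →L[ℝ] E) := fun z ↦ (v z.1, (fderiv ℝ v z.1).comp z.2)
    have hDv : ContDiffAt ℝ ((n : ℕ∞ω) + 1) (fderiv ℝ v) x₀ := by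
      refine hv.fderiv_right (le_of_eq ?_)
      push_cast; rfl
    have hw : ContDiffAt ℝ (n + 1) w (x₀, ContinuousLinearMap.id ℝ E) := by
      refine ContDiffAt.prodMk ?_ (ContDiffAt.clm_comp ?_ contDiffAt_snd)
      · refine (ContDiffAt.of_le hv ?_).comp (x₀, ContinuousLinearMap.id ℝ E) contDiffAt_fst
        push_cast
        exact le_self_add
      · exact ContDiffAt.comp (x₀, ContinuousLinearMap.id ℝ E) hDv contDiffAt_fst
    obtain ⟨β, hβ, hβd, hβ0⟩ := ih hw
    let ι : E × ℝ → (E × (E →L[ℝ] E)) × ℝ := fun p ↦ ((p.1, ContinuousLinearMap.id ℝ E), p.2)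
    have hι : ContDiff ℝ ⊤ ι := (contDiff_fst.prodMk contDiff_const).prodMk contDiff_snd
    let α : E × ℝ → E := fun p ↦ (β (ι p)).1
    let A : E × ℝ → E →L[ℝ] E := fun p ↦ (β (ι p)).2
    have hβι : ContDiffAt ℝ n (fun p ↦ β (ι p)) (x₀, 0) :=
      ContDiffAt.comp (x₀, (0 : ℝ)) hβ (hι.contDiffAt.of_le le_top)
    have hα : ContDiffAt ℝ n α (x₀, 0) := contDiffAt_fst.comp (x₀, (0 : ℝ)) hβι
    have hA : ContDiffAt ℝ n A (x₀, 0) := contDiffAt_snd.comp (x₀, (0 : ℝ)) hβι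
    have hιc : Tendsto ι (𝓝 (x₀, 0)) (𝓝 ((x₀, ContinuousLinearMap.id ℝ E), 0)) :=
      hι.continuous.tendsto _
    have hd : ∀ᶠ p in 𝓝 (x₀, (0 : ℝ)), HasDerivAt (fun t ↦ β (ι (p.1, t))) (w (β (ι p))) p.2 :=
      hιc.eventually hβd
    have h0 : ∀ᶠ x in 𝓝 x₀, α (x, 0) = x ∧ A (x, 0) = ContinuousLinearMap.id ℝ E := by
      have : Tendsto (fun x : E ↦ (x, ContinuousLinearMap.id ℝ E)) (𝓝 x₀)
          (𝓝 (x₀, ContinuousLinearMap.id ℝ E)) := (by fun_prop : Continuous _).tendsto _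
      filter_upwards [this.eventually hβ0] with x hx
      exact ⟨congrArg Prod.fst hx, congrArg Prod.snd hx⟩
    -- A ball around `x₀` on which `Dv` exists, is bounded and is Lipschitz.
    obtain ⟨L, s, hs, hLs⟩ := (hDv.of_le le_add_self).exists_lipschitzOnWith
    have hvd : ∀ᶠ x in 𝓝 x₀, DifferentiableAt ℝ v x := by
      have h1 : ContDiffAt ℝ 1 v x₀ := hv.of_le (by push_cast; exact le_add_self)
      exact (h1.eventually (by simp)).mono fun x hx ↦ hx.differentiableAt (by simp)
    have hvK : ∀ᶠ x in 𝓝 x₀, ‖fderiv ℝ v x‖ < ‖fderiv ℝ v x₀‖ + 1 :=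
      hDv.continuousAt.norm.eventually_lt continuousAt_const (lt_add_one _)
    obtain ⟨R, hR, hball⟩ := Metric.eventually_nhds_iff_ball.1 ((hvd.and hvK).and hs)
    set S := Metric.ball x₀ R
    let K : NNReal := ⟨‖fderiv ℝ v x₀‖ + 1, by positivity⟩
    have hK0 : 0 < K := by
      rw [← NNReal.coe_pos]; change 0 < ‖fderiv ℝ v x₀‖ + 1; positivity
    have hL : ∀ x ∈ S, ∀ y ∈ S, ‖fderiv ℝ v x - fderiv ℝ v y‖ ≤ L * ‖x - y‖ := fun x hx y hy ↦ by
      simpa [dist_eq_norm] using hLs.dist_le_mul x (hball x hx).2 y (hball y hy).2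
    have hαS : ∀ᶠ p in 𝓝 (x₀, (0 : ℝ)), α p ∈ S := by
      refine hα.continuousAt.eventually_mem ?_
      rw [(h0.self_of_nhds).1]
      exact Metric.ball_mem_nhds _ hR
    have hcα : ∀ᶠ p in 𝓝 (x₀, (0 : ℝ)), ContinuousAt α p :=
      (hα.eventually (by simp)).mono fun p hp ↦ hp.continuousAt
    have hcA : ∀ᶠ p in 𝓝 (x₀, (0 : ℝ)), ContinuousAt A p :=
      (hA.eventually (by simp)).mono fun p hp ↦ hp.continuousAt
    have h0' : ∀ᶠ p in 𝓝 (x₀, (0 : ℝ)),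
        α (p.1, 0) = p.1 ∧ A (p.1, 0) = ContinuousLinearMap.id ℝ E :=
      (continuous_fst.tendsto (x₀, (0 : ℝ))).eventually h0
    obtain ⟨r, hr, hQ⟩ :=
      Metric.eventually_nhds_iff_ball.1 ((hd.and hαS).and ((hcα.and hcA).and h0'))
    have hmem : ∀ {y : E} {t : ℝ}, y ∈ Metric.ball x₀ r → |t| < r →
        (y, t) ∈ Metric.ball (x₀, (0 : ℝ)) r := fun hy ht ↦ by
      rw [← ball_prod_same]; exact ⟨hy, by simpa using ht⟩
    have hαd : ∀ p ∈ Metric.ball (x₀, (0 : ℝ)) r,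
        HasDerivAt (fun t ↦ α (p.1, t)) (v (α p)) p.2 := fun p hp ↦ by
      simpa using! ((ContinuousLinearMap.fst ℝ E (E →L[ℝ] E)).hasFDerivAt.comp_hasDerivAt p.2
        (hQ p hp).1.1)
    have hAd : ∀ p ∈ Metric.ball (x₀, (0 : ℝ)) r,
        HasDerivAt (fun t ↦ A (p.1, t)) ((fderiv ℝ v (α p)).comp (A p)) p.2 := fun p hp ↦ by
      simpa using! ((ContinuousLinearMap.snd ℝ E (E →L[ℝ] E)).hasFDerivAt.comp_hasDerivAt p.2
        (hQ p hp).1.1)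
    have hpart : ∀ p ∈ Metric.ball (x₀, (0 : ℝ)) r,
        HasFDerivAt (fun y ↦ α (y, p.2)) (A p) p.1 := by
      rintro ⟨x, T⟩ hp
      have hp' := hp
      rw [← ball_prod_same] at hp'
      obtain ⟨hx, hT⟩ := hp'
      refine hasFDerivAt_flow (α := fun y t ↦ α (y, t)) (A := fun t ↦ A (x, t))
        (convex_ball x₀ R) hK0 L.2 (fun z hz ↦ (hball z hz).1.1)
        (fun z hz ↦ (hball z hz).1.2.le) hL (ε := r) (T := T) (by simpa using hT) ?_ ?_ ?_
      · filter_upwards [Metric.isOpen_ball.mem_nhds hx] with y hy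
        exact ⟨(hQ _ (hmem (t := 0) hy (by simpa using hr))).2.2.1,
          fun t ht ↦ ⟨(hQ _ (hmem hy ht)).1.2, hαd _ (hmem hy ht)⟩⟩
      · exact fun t ht ↦ hAd _ (hmem hx ht)
      · exact (hQ _ hp).2.2.2
    have hvα : ContDiffAt ℝ n (fun p ↦ v (α p)) (x₀, 0) := by
      refine ContDiffAt.comp (x₀, (0 : ℝ)) ?_ hα
      rw [(h0.self_of_nhds).1]
      exact hv.of_le (by push_cast; rw [add_assoc]; exact le_self_add)
    refine ⟨α, ?_, ?_, h0.mono fun x hx ↦ hx.1⟩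
    · push_cast
      refine contDiffAt_succ_iff_hasFDerivAt.2
        ⟨fun p ↦ (A p).comp (ContinuousLinearMap.fst ℝ E ℝ) +
          (ContinuousLinearMap.snd ℝ E ℝ).smulRight (v (α p)),
        ⟨Metric.ball (x₀, (0 : ℝ)) r, Metric.ball_mem_nhds _ hr, fun p hp ↦ ?_⟩, ?_⟩
      · have hnear := Metric.isOpen_ball.eventually_mem hp
        have := hasStrictFDerivAt_uncurry_coprod (𝕜 := ℝ) (u := p) (f := fun x t ↦ α (x, t))
          (f₁ := fun x t ↦ A (x, t))
          (f₂ := fun x t ↦ (ContinuousLinearMap.id ℝ ℝ).smulRight (v (α (x, t))))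
          (hnear.mono fun q hq ↦ hpart q hq)
          (hnear.mono fun q hq ↦ (hαd q hq).hasFDerivAt) (hQ p hp).2.1.2 ?_
        · refine this.hasFDerivAt.congr_fderiv ?_
          ext <;> simp [Function.HasUncurry.uncurry]
        · have hc : ContinuousAt (fun q ↦ v (α q)) p :=
            ContinuousAt.comp (hball _ (hQ p hp).1.2).1.1.continuousAt (hQ p hp).2.1.1
          exact ((ContinuousLinearMap.smulRightL ℝ ℝ E
            (ContinuousLinearMap.id ℝ ℝ)).continuous.continuousAt).comp hc
      · refine (hA.clm_comp contDiffAt_const).add ?_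
        exact ((ContinuousLinearMap.smulRightL ℝ (E × ℝ) E
            (ContinuousLinearMap.snd ℝ E ℝ)).contDiff.contDiffAt).comp (x₀, (0 : ℝ)) hvα
    · filter_upwards [Metric.ball_mem_nhds _ hr] with p hp using hαd p hp

end ODE

/-! ### Smoothness of the global flow of a complete vector field -/

section Flow

variable {E : Type*} [NormedAddCommGroup E] [NormedSpace ℝ E]
  {M : Type*} [TopologicalSpace M] [ChartedSpace E M] [IsManifold 𝓘(ℝ, E) ∞ M]

/-- A global flow of a vector field `X`, given by its trajectories. -/
structure IsFlowOf (φ : M → ℝ → M) (X : (x : M) → TangentSpace 𝓘(ℝ, E) x) : Prop where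
  zero (x : M) : φ x 0 = x
  integralCurve (x : M) : IsMIntegralCurve (I := 𝓘(ℝ, E)) (φ x) X

/-- A solution of the equation of `X` in a chart gives an integral curve on the manifold. -/
theorem hasMFDerivAt_extChartAt_symm_comp {X : (x : M) → TangentSpace 𝓘(ℝ, E) x}
    {x₀ : M} {f : ℝ → E} {t : ℝ}
    (hft : f t ∈ (extChartAt 𝓘(ℝ, E) x₀).target)
    (hf : HasDerivAt f (fderivWithin ℝ (extChartAt 𝓘(ℝ, E) x₀ ∘
      (extChartAt 𝓘(ℝ, E) ((extChartAt 𝓘(ℝ, E) x₀).symm (f t))).symm) (range 𝓘(ℝ, E))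
      (extChartAt 𝓘(ℝ, E) ((extChartAt 𝓘(ℝ, E) x₀).symm (f t))
        ((extChartAt 𝓘(ℝ, E) x₀).symm (f t)))
      (X ((extChartAt 𝓘(ℝ, E) x₀).symm (f t)))) t) :
    HasMFDerivAt 𝓘(ℝ, ℝ) 𝓘(ℝ, E) ((extChartAt 𝓘(ℝ, E) x₀).symm ∘ f) t
      ((1 : ℝ →L[ℝ] ℝ).smulRight (X ((extChartAt 𝓘(ℝ, E) x₀).symm (f t)))) := by
  let xₜ : M := (extChartAt 𝓘(ℝ, E) x₀).symm (f t)
  let w : E := X xₜ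
  have h : HasDerivAt f (tangentCoordChange 𝓘(ℝ, E) xₜ x₀ xₜ w) t := hf
  have hft1 : xₜ ∈ (extChartAt 𝓘(ℝ, E) x₀).source := (extChartAt 𝓘(ℝ, E) x₀).map_target hft
  have hft2 := mem_extChartAt_source (I := 𝓘(ℝ, E)) xₜ
  have hw : tangentCoordChange 𝓘(ℝ, E) x₀ xₜ xₜ (tangentCoordChange 𝓘(ℝ, E) xₜ x₀ xₜ w) = w := by
    rw [tangentCoordChange_comp ⟨⟨hft2, hft1⟩, hft2⟩, tangentCoordChange_self hft2]
  have key : HasDerivAt ((extChartAt 𝓘(ℝ, E) xₜ ∘ (extChartAt 𝓘(ℝ, E) x₀).symm) ∘ f) w t := by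
    rw [← hw]
    apply HasFDerivAt.comp_hasDerivAt _ _ h
    apply HasFDerivWithinAt.hasFDerivAt (s := range 𝓘(ℝ, E)) _ (by simp)
    rw [← (extChartAt 𝓘(ℝ, E) x₀).right_inv hft]
    exact hasFDerivWithinAt_tangentCoordChange ⟨hft1, hft2⟩
  exact ⟨(continuousAt_extChartAt_symm'' hft).comp h.continuousAt,
    key.hasFDerivAt.hasFDerivWithinAt⟩

variable [T2Space M] {φ : M → ℝ → M} {X : (x : M) → TangentSpace 𝓘(ℝ, E) x}

theorem IsFlowOf.add (h : IsFlowOf φ X)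
    (hX : ContMDiff 𝓘(ℝ, E) (𝓘(ℝ, E).tangent) ∞ (fun x ↦ (⟨x, X x⟩ : TangentBundle 𝓘(ℝ, E) M)))
    (x : M) (s t : ℝ) : φ x (s + t) = φ (φ x s) t := by
  have h1 : IsMIntegralCurve (I := 𝓘(ℝ, E)) (φ x ∘ (· + s)) X := (h.integralCurve x).comp_add s
  have h2 := isMIntegralCurve_Ioo_eq_of_contMDiff_boundaryless (t₀ := 0)
    (hX.of_le (by simp)) h1 (h.integralCurve (φ x s)) (by simp [h.zero])
  simpa [add_comm] using! congrFun h2 t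

/-- Near time zero the global flow is the local flow read in a chart, by uniqueness of integral
curves, hence it is smooth there. -/
theorem IsFlowOf.contMDiffAt_zero [CompleteSpace E] (h : IsFlowOf φ X)
    (hX : ContMDiff 𝓘(ℝ, E) (𝓘(ℝ, E).tangent) ∞ (fun x ↦ (⟨x, X x⟩ : TangentBundle 𝓘(ℝ, E) M)))
    (n : ℕ) (x₀ : M) :
    ContMDiffAt (𝓘(ℝ, E).prod 𝓘(ℝ, ℝ)) 𝓘(ℝ, E) n (fun p : M × ℝ ↦ φ p.1 p.2) (x₀, 0) := by
  set e := extChartAt 𝓘(ℝ, E) x₀ with he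
  have hXn := contMDiffAt_iff.1 ((hX.of_le (m := ((n : ℕ∞ω) + 1))
    (by exact_mod_cast le_top)) x₀)
  obtain ⟨α, hα, hαd, hα0⟩ := exists_contDiffAt_local_flow n
    (hXn.2.contDiffAt (by simp)).snd
  have hx₀ : α (e x₀, 0) = e x₀ := hα0.self_of_nhds
  have hec : ContMDiffAt (𝓘(ℝ, E).prod 𝓘(ℝ, ℝ)) (𝓘(ℝ, E).prod 𝓘(ℝ, ℝ)) n
      (fun p : M × ℝ ↦ (e p.1, p.2)) (x₀, 0) :=
    (ContMDiffAt.comp (x₀, (0 : ℝ)) contMDiffAt_extChartAt contMDiffAt_fst).prodMk contMDiffAt_snd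
  have hαM : ContMDiffAt (𝓘(ℝ, E).prod 𝓘(ℝ, ℝ)) 𝓘(ℝ, E) n α (e x₀, 0) := by
    rw [← modelWithCornersSelf_prod, chartedSpaceSelf_prod]
    exact hα.contMDiffAt
  have hcomp : ContMDiffAt (𝓘(ℝ, E).prod 𝓘(ℝ, ℝ)) 𝓘(ℝ, E) n
      (fun p : M × ℝ ↦ α (e p.1, p.2)) (x₀, 0) :=
    ContMDiffAt.comp (x₀, (0 : ℝ)) (g := α) hαM hec
  have hsymm : ContMDiffAt 𝓘(ℝ, E) 𝓘(ℝ, E) n e.symm (α (e x₀, 0)) := by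
    rw [hx₀]
    exact (contMDiffOn_extChartAt_symm x₀).contMDiffAt (extChartAt_target_mem_nhds x₀)
  refine (ContMDiffAt.comp (x₀, (0 : ℝ)) (g := e.symm)
    (f := fun p : M × ℝ ↦ α (e p.1, p.2)) hsymm hcomp).congr_of_eventuallyEq ?_
  -- The two flows agree near `(x₀, 0)`.
  have htarget : ∀ᶠ p : M × ℝ in 𝓝 (x₀, (0 : ℝ)), α (e p.1, p.2) ∈ e.target := by
    refine hcomp.continuousAt.eventually_mem ?_
    rw [hx₀]
    exact extChartAt_target_mem_nhds x₀
  have hd := hec.continuousAt.tendsto.eventually hαd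
  have h1 : ∀ᶠ x in 𝓝 x₀, x ∈ e.source ∧ α (e x, 0) = e x :=
    (show ∀ᶠ x in 𝓝 x₀, x ∈ e.source from extChartAt_source_mem_nhds x₀).and
      ((continuousAt_extChartAt (I := 𝓘(ℝ, E)) x₀).eventually hα0)
  obtain ⟨s, hs, u, hu, hsu⟩ := mem_nhds_prod_iff.1 (hd.and htarget)
  obtain ⟨r, hr, hru⟩ := Metric.mem_nhds_iff.1 hu
  rw [Real.ball_eq_Ioo, zero_sub, zero_add] at hru
  filter_upwards [prod_mem_nhds (Filter.inter_mem hs h1)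
    (Ioo_mem_nhds (neg_lt_zero.2 hr) hr)] with p hp
  obtain ⟨⟨hps, hpe, hp0⟩, hpt⟩ := hp
  have hcurve : IsMIntegralCurveOn (I := 𝓘(ℝ, E)) (e.symm ∘ fun t ↦ α (e p.1, t)) X
      (Ioo (-r) r) := fun t ht ↦ by
    have hm := hsu (mk_mem_prod hps (hru ht))
    exact (hasMFDerivAt_extChartAt_symm_comp hm.2 hm.1).hasMFDerivWithinAt
  exact isMIntegralCurveOn_Ioo_eqOn_of_contMDiff_boundaryless (t₀ := 0)
    ⟨neg_lt_zero.2 hr, hr⟩ (hX.of_le (by simp)) ((h.integralCurve p.1).isMIntegralCurveOn _)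
    hcurve (by simp [h.zero, hp0, e.left_inv hpe]) hpt

/-- The flow is smooth at all times: smoothness for small times is uniform along a compact piece
of a trajectory, and the group law adds up small times. -/
theorem IsFlowOf.contMDiff [CompleteSpace E] (h : IsFlowOf φ X)
    (hX : ContMDiff 𝓘(ℝ, E) (𝓘(ℝ, E).tangent) ∞
      (fun x ↦ (⟨x, X x⟩ : TangentBundle 𝓘(ℝ, E) M))) :
    ContMDiff (𝓘(ℝ, E).prod 𝓘(ℝ, ℝ)) 𝓘(ℝ, E) ∞ (fun p : M × ℝ ↦ φ p.1 p.2) := by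
  refine contMDiff_infty.2 fun n ↦ ?_
  rintro ⟨x, T⟩
  set F : M × ℝ → M := fun p ↦ φ p.1 p.2
  let Sm : M × ℝ → Prop := ContMDiffAt (𝓘(ℝ, E).prod 𝓘(ℝ, ℝ)) 𝓘(ℝ, E) n F
  have hstep : ∀ s t : ℝ, Sm (x, s) → Sm (φ x s, t) → Sm (x, s + t) := fun s t hs ht ↦ by
    have hF : F = F ∘ fun p : M × ℝ ↦ (F (p.1, s), p.2 - s) := by
      ext p
      simp only [F, Function.comp_apply]
      rw [← h.add hX, add_sub_cancel]
    change ContMDiffAt _ _ _ F _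
    rw [hF]
    refine ContMDiffAt.comp_of_eq (y := (φ x s, t)) (I' := 𝓘(ℝ, E).prod 𝓘(ℝ, ℝ)) ht ?_
      (by simp [F])
    refine ContMDiffAt.prodMk ?_ ?_
    · exact ContMDiffAt.comp_of_eq (I' := 𝓘(ℝ, E).prod 𝓘(ℝ, ℝ)) (y := (x, s)) (g := F)
        (f := fun p : M × ℝ ↦ (p.1, s)) hs (contMDiffAt_fst.prodMk contMDiffAt_const) rfl
    · exact contMDiffAt_snd.sub contMDiffAt_const
  have hcont : Continuous (φ x) := (h.integralCurve x).continuous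
  -- A uniform time `ε` of smoothness along the trajectory over `[-|T|, |T|]`.
  obtain ⟨ε, hε, hsm⟩ : ∃ ε > 0, ∀ s ∈ Icc (-|T|) |T|, ∀ t, |t| < ε → Sm (φ x s, t) := by
    have hloc : ∀ s ∈ Icc (-|T|) |T|, ∀ᶠ q : ℝ × ℝ in 𝓝 (0 : ℝ) ×ˢ 𝓝 s, Sm (φ x q.2, q.1) := by
      intro s _
      have h0 := contMDiffAt_iff_contMDiffAt_nhds (by simp) |>.1 (h.contMDiffAt_zero hX n (φ x s))
      have hc : Tendsto (fun q : ℝ × ℝ ↦ (φ x q.2, q.1)) (𝓝 (0 : ℝ) ×ˢ 𝓝 s)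
          (𝓝 (φ x s, (0 : ℝ))) := by
        rw [← nhds_prod_eq]
        exact (by fun_prop : Continuous fun q : ℝ × ℝ ↦ (φ x q.2, q.1)).tendsto (0, s)
      exact hc.eventually h0
    have := isCompact_Icc.eventually_forall_of_forall_eventually (x₀ := (0 : ℝ))
      (K := Icc (-|T|) |T|) (P := fun t s ↦ Sm (φ x s, t))
      (fun s hs ↦ by rw [nhds_prod_eq]; exact hloc s hs)
    obtain ⟨ε, hε, hb⟩ := Metric.eventually_nhds_iff_ball.1 this
    exact ⟨ε, hε, fun s hs t ht ↦ hb t (by simpa using ht) s hs⟩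
  obtain ⟨k, hk⟩ := exists_nat_gt (|T| / ε)
  have hk0 : (0 : ℝ) < k := lt_of_le_of_lt (by positivity) hk
  have hstep_lt : |T / k| < ε := by
    rw [abs_div, Nat.abs_cast, div_lt_iff₀ hk0]
    rwa [div_lt_iff₀ hε, mul_comm] at hk
  have hind : ∀ j : ℕ, j ≤ k → Sm (x, j * (T / k)) := by
    intro j
    induction j with
    | zero => exact fun _ ↦ by simpa using! h.contMDiffAt_zero hX n x
    | succ j ih =>
      intro hj
      have hle : |(j : ℝ) * (T / k)| ≤ |T| := by
        rw [abs_mul, abs_div, Nat.abs_cast, Nat.abs_cast, mul_div_assoc', div_le_iff₀ hk0, mul_comm]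
        gcongr
        omega
      have := hstep _ (T / k) (ih (by omega)) (hsm _ (abs_le.1 hle) _ hstep_lt)
      convert this using 2
      push_cast; ring
  have := hind k le_rfl
  rwa [mul_div_cancel₀ _ hk0.ne'] at this

end Flow

/-! ### The gradient field -/

section Gradient

variable {E : Type*} [NormedAddCommGroup E] [NormedSpace ℝ E]
  {M : Type*} [TopologicalSpace M] [ChartedSpace E M] [IsManifold 𝓘(ℝ, E) ∞ M]

theorem isInvertible_of_apply_self_ne_zero [FiniteDimensional ℝ E] (B : E →L[ℝ] E →L[ℝ] ℝ)
    (hB : ∀ v, v ≠ 0 → B v v ≠ 0) : B.IsInvertible := by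
  have hinj : Function.Injective (B : E →ₗ[ℝ] (E →L[ℝ] ℝ)) := by
    rw [injective_iff_map_eq_zero]
    intro v hv
    by_contra hne
    refine hB v hne ?_
    have : B v = 0 := hv
    simp [this]
  have hdim : Module.finrank ℝ E = Module.finrank ℝ (E →L[ℝ] ℝ) := by
    rw [← (LinearMap.toContinuousLinearMap (𝕜 := ℝ) (E := E) (F' := ℝ)).finrank_eq]
    exact (Subspace.dual_finrank_eq (K := ℝ) (V := E)).symm
  exact ⟨(LinearEquiv.ofInjectiveOfFinrankEq _ hinj hdim).toContinuousLinearEquiv, by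
    ext v w; rfl⟩

/-- The gradient is smooth: in a trivialization of the tangent bundle it is `G⁻¹ N`, for the matrix
`G` of the metric and the coordinates `N` of the form. -/
theorem contMDiff_grad [FiniteDimensional ℝ E] (g : Metric E M) (η : ClosedOneForm E M) :
    ContMDiff 𝓘(ℝ, E) (𝓘(ℝ, E).tangent) ∞
      (fun x ↦ (⟨x, grad g η x⟩ : TangentBundle 𝓘(ℝ, E) M)) := by
  intro x₀
  set e := trivializationAt E (TangentSpace 𝓘(ℝ, E) (M := M)) x₀ with he
  refine (contMDiffAt_section (F := E) (E := TangentSpace 𝓘(ℝ, E) (M := M)) x₀).2 ?_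
  have hG := ((contMDiffAt_hom_bundle _).1 (g.contMDiff x₀)).2
  have hN := ((contMDiffAt_hom_bundle _).1 (η.smooth x₀)).2
  simp only at hG hN
  -- `G` and `N` are the metric and the form in the trivialization at `x₀`.
  set G : M → E →L[ℝ] E →L[ℝ] ℝ := fun x ↦ ContinuousLinearMap.inCoordinates E
    (TangentSpace 𝓘(ℝ, E) (M := M)) (E →L[ℝ] ℝ) (fun x ↦ TangentSpace 𝓘(ℝ, E) x →L[ℝ] ℝ)
    x₀ x x₀ x (g.inner x)
  set N : M → E →L[ℝ] ℝ := fun x ↦ ContinuousLinearMap.inCoordinates E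
    (TangentSpace 𝓘(ℝ, E) (M := M)) ℝ (Bundle.Trivial M ℝ)
    x₀ x x₀ x (η.toFun x)
  have hGapply : ∀ x ∈ e.baseSet, ∀ u w, G x u w = g.inner x (e.symm x u) (e.symm x w) := by
    intro x hx u w
    have := inCoordinates_apply_eq₂ (𝕜 := ℝ) (F₁ := E) (F₂ := E) (F₃ := ℝ)
      (E₁ := TangentSpace 𝓘(ℝ, E) (M := M)) (E₂ := TangentSpace 𝓘(ℝ, E) (M := M))
      (E₃ := Bundle.Trivial M ℝ) (ϕ := g.inner x) (v := u) (w := w) hx hx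
      (Set.mem_univ x : x ∈ (trivializationAt ℝ (Bundle.Trivial M ℝ) x₀).baseSet)
    refine this.trans ?_
    simp [he]
  have hNapply : ∀ x ∈ e.baseSet, ∀ w, N x w = η.toFun x (e.symm x w) := by
    intro x hx w
    simp only [N]
    rw [ContinuousLinearMap.inCoordinates_eq (E' := Bundle.Trivial M ℝ) hx
      (Set.mem_univ x : x ∈ (trivializationAt ℝ (Bundle.Trivial M ℝ) x₀).baseSet)]
    simp [he]
  have hsymm0 : ∀ x ∈ e.baseSet, ∀ u, u ≠ 0 → e.symm x u ≠ 0 := by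
    intro x hx u hu h0
    apply hu
    have := e.apply_mk_symm hx u
    rw [h0] at this
    have h2 := congrArg Prod.snd (e.zeroSection ℝ hx)
    simp only [zeroSection] at h2
    rw [this] at h2
    exact h2
  have hinv : ∀ x ∈ e.baseSet, (G x).IsInvertible := fun x hx ↦
    isInvertible_of_apply_self_ne_zero _ fun u hu ↦ by
      rw [hGapply x hx]; exact (g.pos x _ (hsymm0 x hx u hu)).ne'
  have hx₀ : x₀ ∈ e.baseSet := mem_baseSet_trivializationAt E _ x₀
  have hGinv : ContMDiffAt 𝓘(ℝ, E) 𝓘(ℝ, (E →L[ℝ] ℝ) →L[ℝ] E) ∞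
      (fun x ↦ ContinuousLinearMap.inverse (G x)) x₀ := by
    obtain ⟨A, hA⟩ := hinv x₀ hx₀
    have : ContDiffAt ℝ ∞ ContinuousLinearMap.inverse (G x₀) := hA ▸ contDiffAt_map_inverse A
    exact ContMDiffAt.comp x₀ this.contMDiffAt hG
  refine (hGinv.clm_apply hN).congr_of_eventuallyEq ?_
  filter_upwards [e.open_baseSet.mem_nhds hx₀] with x hx
  symm
  rw [(hinv x hx).inverse_apply_eq]
  ext w
  change N x w = _
  rw [hNapply x hx, hGapply x hx, e.symm_apply_apply_mk hx, inner_grad]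

/-- The Cauchy–Schwarz inequality for a Riemannian metric. -/
theorem inner_sq_le (g : Metric E M) (x : M) (v w : TangentSpace 𝓘(ℝ, E) x) :
    g.inner x v w ^ 2 ≤ g.inner x v v * g.inner x w w := by
  have hpos : ∀ u, 0 ≤ g.inner x u u := fun u ↦ by
    by_cases h : u = 0
    · simp [h]
    · exact (g.pos x u h).le
  have h : ∀ t : ℝ, 0 ≤ g.inner x w w * (t * t) + 2 * g.inner x v w * t + g.inner x v v := by
    intro t
    have := hpos (v + t • w)
    simp only [map_add, map_smul, add_apply, smul_apply, smul_eq_mul] at this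
    rw [g.symm x w v] at this
    linarith
  have := discrim_le_zero h
  rw [discrim] at this
  linarith

/-- The value of the form on its gradient, that is `|grad|²`: the rate at which the gradient flow
decreases the integral of the form. -/
def gradRate [FiniteDimensional ℝ E] (g : Metric E M) (η : ClosedOneForm E M) (x : M) : ℝ :=
  η.toFun x (grad g η x)

section

variable [FiniteDimensional ℝ E] (g : Metric E M) (η : ClosedOneForm E M)

theorem gradRate_eq_inner (x : M) : gradRate g η x = g.inner x (grad g η x) (grad g η x) :=
  (inner_grad g η x _).symm

theorem gradRate_nonneg (x : M) : 0 ≤ gradRate g η x := by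
  rw [gradRate_eq_inner]
  by_cases h : grad g η x = 0
  · simp [h]
  · exact (g.pos x _ h).le

theorem norm_grad_sq (x : M) : Metric.norm g (grad g η x) ^ 2 = gradRate g η x := by
  rw [Metric.norm, ← gradRate_eq_inner, Real.sq_sqrt (gradRate_nonneg g η x)]

theorem grad_eq_zero_of_gradRate {x : M} (h : gradRate g η x = 0) : grad g η x = 0 := by
  by_contra hne
  have := g.pos x _ hne
  rw [← gradRate_eq_inner, h] at this
  exact lt_irrefl _ this

theorem setOf_gradRate_eq_zero : {x | gradRate g η x = 0} = η.zeros := by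
  ext x
  constructor
  · intro h
    refine ContinuousLinearMap.ext fun w ↦ ?_
    rw [← inner_grad g η x w, grad_eq_zero_of_gradRate g η h]
    simp
  · intro h
    have h' : η.toFun x = 0 := h
    simp [gradRate, h']

theorem continuous_gradRate : Continuous (gradRate g η) := by
  have : ContMDiff 𝓘(ℝ, E) (𝓘(ℝ, E).prod 𝓘(ℝ, ℝ)) ∞
      (fun x ↦ TotalSpace.mk' ℝ (E := Bundle.Trivial M ℝ) x (gradRate g η x)) :=
    ContMDiff.clm_bundle_apply (F₁ := E) (E₁ := TangentSpace 𝓘(ℝ, E) (M := M))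
      (E₂ := Bundle.Trivial M ℝ) (ϕ := η.toFun) η.smooth (contMDiff_grad g η)
  have h2 : ContMDiff 𝓘(ℝ, E) 𝓘(ℝ, ℝ) ∞ (gradRate g η) := fun x ↦
    ((contMDiffAt_totalSpace).1 (this x)).2
  exact h2.continuous

theorem contMDiff_neg_grad : ContMDiff 𝓘(ℝ, E) (𝓘(ℝ, E).tangent) ∞
    (fun x ↦ (⟨x, -grad g η x⟩ : TangentBundle 𝓘(ℝ, E) M)) :=
  (contMDiff_grad g η).neg_section

/-- If `g' ≤ C g` with `C ≥ 1`, the lower bound on the length of the gradient passes from `g` to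
`g'` with the factor `1 / C`. -/
theorem le_norm_grad_of_le (g' : Metric E M) {c C : ℝ} (hc : 0 < c) (hC : 1 ≤ C) {x : M}
    (hle : ∀ v : TangentSpace 𝓘(ℝ, E) x, g'.inner x v v ≤ C * g.inner x v v)
    (h : c ≤ Metric.norm g (grad g η x)) : c / C ≤ Metric.norm g' (grad g' η x) := by
  have hC0 : 0 < C := lt_of_lt_of_le one_pos hC
  have hcq : c ^ 2 ≤ gradRate g η x := by
    rw [← norm_grad_sq]; gcongr
  have hq : 0 < gradRate g η x := lt_of_lt_of_le (by positivity) hcq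
  -- `η(grad_g)² = g'(grad_g', grad_g)² ≤ |grad_g'|² · C |grad_g|²`
  have h1 : gradRate g η x ^ 2 ≤ gradRate g' η x * (C * gradRate g η x) := by
    calc gradRate g η x ^ 2 = g'.inner x (grad g' η x) (grad g η x) ^ 2 := by
          rw [inner_grad]; rfl
      _ ≤ gradRate g' η x * g'.inner x (grad g η x) (grad g η x) := by
          rw [gradRate_eq_inner g']; exact inner_sq_le g' x _ _
      _ ≤ gradRate g' η x * (C * gradRate g η x) := by
          rw [gradRate_eq_inner g]
          exact mul_le_mul_of_nonneg_left (hle _) (gradRate_nonneg g' η x)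
  have h2 : gradRate g η x ≤ C * gradRate g' η x := by
    have : gradRate g η x * gradRate g η x ≤ (C * gradRate g' η x) * gradRate g η x := by
      nlinarith
    exact le_of_mul_le_mul_right this hq
  rw [Metric.norm, ← gradRate_eq_inner]
  refine Real.le_sqrt_of_sq_le ?_
  rw [div_pow, div_le_iff₀ (by positivity)]
  have h3 := mul_le_mul_of_nonneg_left hC (mul_nonneg hC0.le (gradRate_nonneg g' η x))
  nlinarith

end

end Gradient

/-! ### Flows with a non-negative dissipation rate -/

section Dynamics

variable {M : Type*} [TopologicalSpace M]

/-- A continuous flow `φ` together with a continuous rate `q ≥ 0` whose zeros are rest points. For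
the gradient flow of a closed 1-form, `q = |grad|²`. -/
structure IsDissipative (φ : M → ℝ → M) (q : M → ℝ) : Prop where
  continuous_flow : Continuous fun p : M × ℝ ↦ φ p.1 p.2
  zero (x : M) : φ x 0 = x
  add (x : M) (s t : ℝ) : φ x (s + t) = φ (φ x s) t
  continuous_rate : Continuous q
  nonneg (x : M) : 0 ≤ q x
  fixed (x : M) (hx : q x = 0) (t : ℝ) : φ x t = x

/-- The amount dissipated along the trajectory of `x` up to time `t`. For a gradient flow it is
minus the integral of the 1-form along this piece of trajectory. -/
def drop (φ : M → ℝ → M) (q : M → ℝ) (x : M) (t : ℝ) : ℝ := ∫ s in (0 : ℝ)..t, q (φ x s)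

variable {φ : M → ℝ → M} {q : M → ℝ}

namespace IsDissipative

theorem continuous_trajectory (h : IsDissipative φ q) (x : M) : Continuous (φ x) :=
  h.continuous_flow.comp (by fun_prop : Continuous fun t : ℝ ↦ (x, t))

theorem tendsto_flow (h : IsDissipative φ q) {ι : Type*} {l : Filter ι} {f : ι → M} {τ : ι → ℝ}
    {x : M} {t : ℝ} (hf : Tendsto f l (𝓝 x)) (hτ : Tendsto τ l (𝓝 t)) :
    Tendsto (fun a ↦ φ (f a) (τ a)) l (𝓝 (φ x t)) :=
  (h.continuous_flow.tendsto (x, t)).comp (hf.prodMk_nhds hτ)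

theorem intervalIntegrable (h : IsDissipative φ q) (x : M) (a b : ℝ) :
    IntervalIntegrable (fun s ↦ q (φ x s)) MeasureTheory.volume a b :=
  (h.continuous_rate.comp (h.continuous_trajectory x)).intervalIntegrable a b

theorem continuous_drop (h : IsDissipative φ q) :
    Continuous fun p : M × ℝ ↦ drop φ q p.1 p.2 := by
  have : Continuous (Function.uncurry fun (p : M × ℝ) (s : ℝ) ↦ q (φ p.1 s)) :=
    h.continuous_rate.comp (h.continuous_flow.comp
      (by fun_prop : Continuous fun a : (M × ℝ) × ℝ ↦ (a.1.1, a.2)))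
  exact intervalIntegral.continuous_parametric_intervalIntegral_of_continuous this continuous_snd

theorem tendsto_drop (h : IsDissipative φ q) {ι : Type*} {l : Filter ι} {f : ι → M} {x : M}
    (hf : Tendsto f l (𝓝 x)) (t : ℝ) :
    Tendsto (fun a ↦ drop φ q (f a) t) l (𝓝 (drop φ q x t)) :=
  (h.continuous_drop.tendsto (x, t)).comp (hf.prodMk_nhds tendsto_const_nhds)

theorem drop_add (h : IsDissipative φ q) (x : M) (s t : ℝ) :
    drop φ q x (s + t) = drop φ q x s + drop φ q (φ x s) t := by
  have h1 : drop φ q (φ x s) t = ∫ r in s..(s + t), q (φ x r) := by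
    simp_rw [drop, ← h.add]
    rw [intervalIntegral.integral_comp_add_left (fun r ↦ q (φ x r)) s, add_zero]
  rw [h1, drop, drop, intervalIntegral.integral_add_adjacent_intervals
    (h.intervalIntegrable x _ _) (h.intervalIntegrable x _ _)]

theorem drop_nonneg (h : IsDissipative φ q) (x : M) {t : ℝ} (ht : 0 ≤ t) : 0 ≤ drop φ q x t :=
  intervalIntegral.integral_nonneg ht fun _ _ ↦ h.nonneg _

theorem drop_mono (h : IsDissipative φ q) (x : M) : Monotone (drop φ q x) := by
  intro s t hst
  have := h.drop_add x s (t - s)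
  rw [add_sub_cancel] at this
  linarith [h.drop_nonneg (φ x s) (sub_nonneg.2 hst)]

theorem rate_eq_zero_of_drop (h : IsDissipative φ q) {x : M} (hx : drop φ q x 1 = 0) :
    q x = 0 := by
  have hcont : Continuous fun s ↦ q (φ x s) := h.continuous_rate.comp (h.continuous_trajectory x)
  by_contra hne
  have hpos : 0 < q (φ x 0) := by
    rw [h.zero]; exact lt_of_le_of_ne (h.nonneg x) (Ne.symm hne)
  have := intervalIntegral.integral_pos (f := fun s ↦ q (φ x s)) zero_lt_one hcont.continuousOn
    (fun _ _ ↦ h.nonneg _) ⟨0, by simp, hpos⟩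
  exact this.ne' hx

/-- LaSalle's principle: if the dissipation along a trajectory converges at an end, then the
cluster points of the trajectory at this end are zeros of the rate. -/
theorem rate_eq_zero_of_mapClusterPt (h : IsDissipative φ q) {x z : M} {l : Filter ℝ} {L : ℝ}
    (hl : Tendsto (fun t : ℝ ↦ t + 1) l l) (hL : Tendsto (drop φ q x) l (𝓝 L))
    (hz : MapClusterPt z l (φ x)) : q z = 0 := by
  refine h.rate_eq_zero_of_drop ?_
  have hc : Continuous fun w : M ↦ drop φ q w 1 :=
    h.continuous_drop.comp (by fun_prop : Continuous fun w : M ↦ (w, (1 : ℝ)))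
  have h1 : MapClusterPt (drop φ q z 1) l fun t ↦ drop φ q (φ x t) 1 :=
    hz.continuousAt_comp hc.continuousAt
  have h2 : Tendsto (fun t ↦ drop φ q (φ x t) 1) l (𝓝 0) := by
    have := (hL.comp hl).sub hL
    rw [sub_self] at this
    refine this.congr fun t ↦ ?_
    simp [h.drop_add x t 1]
  exact @eq_of_nhds_neBot _ _ _ _ _ (NeBot.mono h1 (inf_le_inf_left _ h2))

end IsDissipative

/-- A path that returns to a compact set infinitely often, and whose cluster points lie in a finite
set, converges: otherwise it would cross the boundary of a small compact neighborhood of a cluster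
point infinitely often, and have a cluster point there. -/
theorem exists_tendsto_of_frequently_mem_compact [T2Space M] [LocallyCompactSpace M] {γ : ℝ → M}
    (hγ : Continuous γ) {Z K : Set M} (hZ : Z.Finite) (hK : IsCompact K)
    (hcl : ∀ z, MapClusterPt z atTop γ → z ∈ Z) (hfreq : ∃ᶠ t in atTop, γ t ∈ K) :
    ∃ p ∈ Z, Tendsto γ atTop (𝓝 p) := by
  obtain ⟨p, -, hp⟩ := hK.exists_mapClusterPt_of_frequently hfreq
  refine ⟨p, hcl p hp, ?_⟩
  rw [tendsto_def]
  intro O hO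
  have hO' : O ∩ (Z \ {p})ᶜ ∈ 𝓝 p :=
    inter_mem hO (hZ.subset sdiff_subset |>.isClosed.isOpen_compl.mem_nhds (by simp))
  obtain ⟨W, hW, hWO, hWc⟩ := local_compact_nhds hO'
  suffices ∀ᶠ t in atTop, γ t ∈ W from this.mono fun t ht ↦ (hWO ht).1
  by_contra hev
  rw [not_eventually] at hev
  have hint : ∃ᶠ t in atTop, γ t ∈ interior W :=
    hp.frequently (isOpen_interior.mem_nhds (mem_interior_iff_mem_nhds.2 hW))
  have hfr : ∃ᶠ t in atTop, γ t ∈ frontier W := by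
    rw [frequently_atTop] at hint hev ⊢
    intro T
    obtain ⟨t₁, hT, h1⟩ := hint T
    obtain ⟨t₂, ht, h2⟩ := hev t₁
    have hpre : IsPreconnected (γ '' Icc t₁ t₂) := isPreconnected_Icc.image _ hγ.continuousOn
    by_contra! hno
    obtain ⟨w, -, hw⟩ := hpre (interior W) Wᶜ isOpen_interior hWc.isClosed.isOpen_compl
      (by
        rintro _ ⟨t, ht', rfl⟩
        by_contra hm
        rw [mem_union, not_or, notMem_compl_iff] at hm
        exact hno t (hT.trans ht'.1) ⟨subset_closure hm.2, hm.1⟩)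
      ⟨_, mem_image_of_mem _ (left_mem_Icc.2 ht), h1⟩
      ⟨_, mem_image_of_mem _ (right_mem_Icc.2 ht), h2⟩
    exact hw.2 (interior_subset hw.1)
  have hfc : IsCompact (frontier W) :=
    hWc.of_isClosed_subset isClosed_frontier hWc.isClosed.frontier_subset
  obtain ⟨z, hzW, hz⟩ := hfc.exists_mapClusterPt_of_frequently hfr
  have hzp : z = p := by
    by_contra hne
    exact (hWO (hWc.isClosed.frontier_subset hzW)).2 ⟨hcl z hz, hne⟩
  rw [hzp] at hzW
  exact hzW.2 (mem_interior_iff_mem_nhds.2 hW)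

namespace IsDissipative

/-- A trajectory of bounded dissipation, of a flow whose rate is bounded below off a compact set,
converges to a zero of the rate. -/
theorem exists_tendsto_atTop [T2Space M] [LocallyCompactSpace M] (h : IsDissipative φ q)
    (hZ : {x | q x = 0}.Finite) {K : Set M} (hK : IsCompact K) {c : ℝ} (hc : 0 < c)
    (hq : ∀ x ∉ K, c ≤ q x) {x : M} {D : ℝ} (hD : ∀ t, 0 ≤ t → drop φ q x t ≤ D) :
    ∃ p, q p = 0 ∧ Tendsto (φ x) atTop (𝓝 p) := by
  have hbdd : BddAbove (range (drop φ q x)) := ⟨D, by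
    rintro _ ⟨t, rfl⟩
    exact (h.drop_mono x (le_max_left t 0)).trans (hD _ (le_max_right _ _))⟩
  refine exists_tendsto_of_frequently_mem_compact (h.continuous_trajectory x) hZ hK
    (fun z hz ↦ h.rate_eq_zero_of_mapClusterPt (tendsto_atTop_add_const_right _ _ tendsto_id)
      (tendsto_atTop_ciSup (h.drop_mono x) hbdd) hz) ?_
  -- Otherwise the rate would be at least `c` from some time on.
  intro hev
  obtain ⟨T, hT⟩ := eventually_atTop.1 hev
  have hlow : ∀ t, 0 ≤ t → c * t ≤ drop φ q (φ x T) t := by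
    intro t ht
    have : ∫ _ in (0 : ℝ)..t, c ≤ drop φ q (φ x T) t := by
      refine intervalIntegral.integral_mono_on ht (by simp) (h.intervalIntegrable _ _ _) ?_
      intro s hs
      refine hq _ ?_
      rw [← h.add]
      exact hT _ (by linarith [hs.1])
    simpa [mul_comm] using this
  set t := (D - drop φ q x T + 1) / c + |T| with ht
  have hDT : drop φ q x T ≤ D :=
    (h.drop_mono x (le_max_left T 0)).trans (hD _ (le_max_right _ _))
  have h0 : 0 ≤ (D - drop φ q x T + 1) / c := by
    apply div_nonneg _ hc.le; linarith
  have h1 := hlow t (by positivity)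
  have h2 := hD (T + t) (by linarith [neg_abs_le T])
  rw [h.drop_add] at h2
  have h3 : D - drop φ q x T + 1 ≤ c * t := by
    rw [ht, mul_add, mul_div_cancel₀ _ hc.ne']
    linarith [mul_nonneg hc.le (abs_nonneg T)]
  linarith

/-- A backward trajectory of bounded dissipation that stays in a compact set converges to a zero of
the rate. -/
theorem exists_tendsto_atBot [T2Space M] [LocallyCompactSpace M] (h : IsDissipative φ q)
    (hZ : {x | q x = 0}.Finite) {K : Set M} (hK : IsCompact K) {x : M}
    (hx : ∀ t, t ≤ 0 → φ x t ∈ K) {D : ℝ} (hD : ∀ t, t ≤ 0 → -D ≤ drop φ q x t) :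
    ∃ p, q p = 0 ∧ Tendsto (φ x) atBot (𝓝 p) := by
  have hbdd : BddBelow (range (drop φ q x)) := ⟨-D, by
    rintro _ ⟨t, rfl⟩
    exact (hD _ (min_le_right _ _)).trans (h.drop_mono x (min_le_left t 0))⟩
  have hmap : ∀ z, MapClusterPt z atTop (fun t ↦ φ x (-t)) → MapClusterPt z atBot (φ x) := by
    intro z hz
    have : map (fun t ↦ φ x (-t)) atTop = map (φ x) atBot := by
      rw [← map_neg_atTop, map_map]; rfl
    rw [MapClusterPt, ← this]; exact hz
  obtain ⟨p, hp, hlim⟩ := exists_tendsto_of_frequently_mem_compact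
    ((h.continuous_trajectory x).comp continuous_neg) hZ hK
    (fun z hz ↦ h.rate_eq_zero_of_mapClusterPt (tendsto_atBot_add_const_right _ _ tendsto_id)
      (tendsto_atBot_ciInf (h.drop_mono x) hbdd) (hmap z hz))
    ((eventually_ge_atTop (0 : ℝ)).mono fun t ht ↦ hx _ (neg_nonpos.2 ht)).frequently
  refine ⟨p, hp, ?_⟩
  have := hlim.comp tendsto_neg_atBot_atTop
  simpa [Function.comp_def] using this

end IsDissipative

/-! ### Heteroclinic chains -/

/-- There is a non-constant trajectory from the zero `p` of the rate to the zero `p'`. -/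
def Heteroclinic (φ : M → ℝ → M) (q : M → ℝ) (p p' : {x | q x = 0}) : Prop :=
  ∃ y, q y ≠ 0 ∧ Tendsto (φ y) atBot (𝓝 (p : M)) ∧ Tendsto (φ y) atTop (𝓝 (p' : M))

/-- There are trajectory pieces from arbitrarily close to `p` to arbitrarily close to `p'`, of
dissipation at most `D`, that leave `W` in between. -/
def Escapes (φ : M → ℝ → M) (q : M → ℝ) (D : ℝ) (W : Set M) (p p' : M) : Prop :=
  ∀ B ∈ 𝓝 p, ∀ B' ∈ 𝓝 p', ∃ x ∈ B, ∃ s t, 0 ≤ s ∧ s ≤ t ∧ φ x t ∈ B' ∧ drop φ q x t ≤ D ∧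
    φ x s ∉ W

namespace IsDissipative

/-- A trajectory that leaves an open set has a first exit time. -/
theorem exists_first_exit (h : IsDissipative φ q) {W : Set M} (hW : IsOpen W) {x : M} (hx : x ∈ W)
    {s : ℝ} (hs : 0 ≤ s) (hxs : φ x s ∉ W) :
    ∃ s', 0 ≤ s' ∧ s' ≤ s ∧ φ x s' ∈ closure W \ W ∧ ∀ r, 0 ≤ r → r ≤ s' → φ x r ∈ closure W := by
  have hcomp : IsCompact (Icc 0 s ∩ φ x ⁻¹' Wᶜ) :=
    isCompact_Icc.inter_right (hW.isClosed_compl.preimage (h.continuous_trajectory x))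
  obtain ⟨s', ⟨⟨h0, h1⟩, h2⟩, hmin⟩ := hcomp.exists_isLeast ⟨s, ⟨hs, le_rfl⟩, hxs⟩
  have hbefore : ∀ r, 0 ≤ r → r < s' → φ x r ∈ W := fun r hr hrs ↦ by
    by_contra hn
    exact absurd (hmin ⟨⟨hr, hrs.le.trans h1⟩, hn⟩) (not_le.2 hrs)
  have hpos : 0 < s' := by
    rcases h0.eq_or_lt with h0 | h0
    · rw [← h0, mem_preimage, h.zero] at h2
      exact absurd hx h2
    · exact h0
  have hcl : φ x s' ∈ closure W := by
    have hlim : Tendsto (φ x) (𝓝[<] s') (𝓝 (φ x s')) :=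
      (h.continuous_trajectory x).continuousAt.tendsto.mono_left nhdsWithin_le_nhds
    refine mem_closure_of_tendsto hlim ?_
    filter_upwards [Ioo_mem_nhdsLT hpos] with r hr using hbefore r hr.1.le hr.2
  refine ⟨s', h0, h1, ⟨hcl, h2⟩, fun r hr hrs ↦ ?_⟩
  rcases hrs.eq_or_lt with rfl | hlt
  · exact hcl
  · exact subset_closure (hbefore r hr hlt)

/-- The limiting step: if trajectory pieces of bounded dissipation go from near `p` to near `p'` and
leave `W` in between, their first exit points from `W` accumulate at a point `y` whose trajectory
connects `p` to a zero `p₂`. Either `p₂ = p'`, or the pieces pass near `p₂` and go on to `p'`. -/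
theorem heteroclinic_of_escapes [T2Space M] [LocallyCompactSpace M] (h : IsDissipative φ q)
    (hZ : {x | q x = 0}.Finite) {K : Set M} (hK : IsCompact K) {c : ℝ} (hc : 0 < c)
    (hq : ∀ x ∉ K, c ≤ q x) {D : ℝ} (W : {x | q x = 0} → Set M) (hWo : ∀ p, IsOpen (W p))
    (hWp : ∀ p : {x | q x = 0}, (p : M) ∈ W p) (hWc : ∀ p, IsCompact (closure (W p)))
    (hWZ : ∀ p : {x | q x = 0}, ∀ z ∈ closure (W p), q z = 0 → z = p) {p p' : {x | q x = 0}}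
    (hesc : Escapes φ q D (W p) p p') :
    ∃ p₂, Heteroclinic φ q p p₂ ∧ (p₂ = p' ∨ Escapes φ q D (W p₂) p₂ p') := by
  -- Triples `(x, s, t)`: initial point, first exit time from `W p`, final time.
  let S : Set (M × ℝ × ℝ) := {a | 0 ≤ a.2.1 ∧ a.2.1 ≤ a.2.2 ∧ drop φ q a.1 a.2.2 ≤ D ∧
    φ a.1 a.2.1 ∈ closure (W p) \ W p ∧ ∀ r, 0 ≤ r → r ≤ a.2.1 → φ a.1 r ∈ closure (W p)}
  have hne : (comap (fun a : M × ℝ × ℝ ↦ (a.1, φ a.1 a.2.2)) (𝓝 ((p : M), (p' : M))) ⊓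
      𝓟 S).NeBot := by
    rw [inf_principal_neBot_iff]
    rintro A ⟨V, hV, hVA⟩
    obtain ⟨B, hB, B', hB', hBV⟩ := mem_nhds_prod_iff.1 hV
    obtain ⟨x, hx, s, t, hs, hst, ht, hD, hxs⟩ :=
      hesc (B ∩ W p) (inter_mem hB ((hWo p).mem_nhds (hWp p))) B' hB'
    obtain ⟨s', h0, h1, h2, h3⟩ := h.exists_first_exit (hWo p) hx.2 hs hxs
    exact ⟨(x, s', t), hVA (hBV ⟨hx.1, ht⟩), h0, h1.trans hst, hD, h2, h3⟩
  let 𝒰 : Ultrafilter (M × ℝ × ℝ) := @Ultrafilter.of _ _ hne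
  have h𝒰 := @Ultrafilter.of_le _ _ hne
  have hS : ∀ᶠ a in (𝒰 : Filter (M × ℝ × ℝ)), a ∈ S :=
    h𝒰.trans inf_le_right (mem_principal_self S)
  have hlim : Tendsto (fun a : M × ℝ × ℝ ↦ (a.1, φ a.1 a.2.2)) 𝒰 (𝓝 ((p : M), (p' : M))) :=
    tendsto_comap.mono_left (h𝒰.trans inf_le_left)
  have hlx : Tendsto (fun a : M × ℝ × ℝ ↦ a.1) 𝒰 (𝓝 (p : M)) :=
    (continuous_fst.tendsto _).comp hlim
  have hlt : Tendsto (fun a : M × ℝ × ℝ ↦ φ a.1 a.2.2) 𝒰 (𝓝 (p' : M)) :=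
    (continuous_snd.tendsto _).comp hlim
  obtain ⟨y, hyW, hy⟩ := ((hWc p).diff (hWo p)).ultrafilter_le_nhds'
    (𝒰.map fun a ↦ φ a.1 a.2.1) (by
      exact hS.mono fun a ha ↦ ha.2.2.2.1)
  have hy : Tendsto (fun a : M × ℝ × ℝ ↦ φ a.1 a.2.1) 𝒰 (𝓝 y) := hy
  have hqy : q y ≠ 0 := fun h0 ↦ hyW.2 (by rw [hWZ p y hyW.1 h0]; exact hWp p)
  -- A time that stays bounded along the ultrafilter converges.
  have hbd : ∀ (τ : M × ℝ × ℝ → ℝ) (T : ℝ), (∀ᶠ a in (𝒰 : Filter (M × ℝ × ℝ)), 0 ≤ τ a) →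
      (¬ ∀ᶠ a in (𝒰 : Filter (M × ℝ × ℝ)), T ≤ τ a) → ∃ r, Tendsto τ 𝒰 (𝓝 r) := by
    intro τ T h0 hT
    rw [← Ultrafilter.eventually_not] at hT
    obtain ⟨r, -, hr⟩ := (isCompact_Icc (a := (0 : ℝ)) (b := T)).ultrafilter_le_nhds' (𝒰.map τ)
      ((h0.and hT).mono fun a ha ↦ ⟨ha.1, (not_le.1 ha.2).le⟩)
    exact ⟨r, hr⟩
  have hs_large : ∀ T : ℝ, ∀ᶠ a in (𝒰 : Filter (M × ℝ × ℝ)), T ≤ a.2.1 := by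
    intro T
    by_contra hT
    obtain ⟨r, hr⟩ := hbd (fun a ↦ a.2.1) T (hS.mono fun a ha ↦ ha.1) hT
    have := tendsto_nhds_unique hy (h.tendsto_flow hlx hr)
    rw [h.fixed _ p.2] at this
    exact hyW.2 (this ▸ hWp p)
  have hts_large : ∀ T : ℝ, ∀ᶠ a in (𝒰 : Filter (M × ℝ × ℝ)), T ≤ a.2.2 - a.2.1 := by
    intro T
    by_contra hT
    obtain ⟨r, hr⟩ := hbd (fun a ↦ a.2.2 - a.2.1) T (hS.mono fun a ha ↦ sub_nonneg.2 ha.2.1) hT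
    have h1 := h.tendsto_flow hy hr
    simp_rw [← h.add, add_sub_cancel] at h1
    have h2 : (p' : M) = φ y r := tendsto_nhds_unique hlt h1
    have h3 : y = p' := by
      rw [← h.fixed _ p'.2 (-r), h2, ← h.add, add_neg_cancel, h.zero]
    exact hqy (h3 ▸ p'.2)
  -- The backward trajectory of `y` stays in the closure of `W p` and dissipates at most `D`.
  have hback : ∀ r, r ≤ 0 → φ y r ∈ closure (W p) := by
    intro r hr
    have h1 := h.tendsto_flow hy (tendsto_const_nhds (x := r))
    refine isClosed_closure.mem_of_tendsto h1 ?_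
    filter_upwards [hS, hs_large (-r)] with a ha hsa
    rw [← h.add]
    exact ha.2.2.2.2 _ (by linarith) (by linarith)
  have hbackD : ∀ r, r ≤ 0 → -D ≤ drop φ q y r := by
    intro r hr
    refine ge_of_tendsto (h.tendsto_drop hy r) ?_
    filter_upwards [hS, hs_large (-r)] with a ha hsa
    have h1 := h.drop_add a.1 a.2.1 r
    have h2 := h.drop_nonneg a.1 (t := a.2.1 + r) (by linarith)
    have h3 := h.drop_mono a.1 ha.2.1
    linarith [ha.2.2.1]
  have hforD : ∀ r, 0 ≤ r → drop φ q y r ≤ D := by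
    intro r hr
    refine le_of_tendsto (h.tendsto_drop hy r) ?_
    filter_upwards [hS, hts_large r] with a ha hsa
    have h1 := h.drop_add a.1 a.2.1 r
    have h2 := h.drop_nonneg a.1 ha.1
    have h3 := h.drop_mono a.1 (by linarith : a.2.1 + r ≤ a.2.2)
    linarith [ha.2.2.1]
  obtain ⟨p₁, hp₁, hlim₁⟩ := h.exists_tendsto_atBot hZ (hWc p) hback hbackD
  obtain ⟨p₂, hp₂, hlim₂⟩ := h.exists_tendsto_atTop hZ hK hc hq hforD
  have hp₁p : p₁ = p := hWZ p _ (isClosed_closure.mem_of_tendsto hlim₁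
    ((eventually_le_atBot 0).mono hback)) hp₁
  refine ⟨⟨p₂, hp₂⟩, ⟨y, hqy, hp₁p ▸ hlim₁, hlim₂⟩, ?_⟩
  by_cases hpp : (⟨p₂, hp₂⟩ : {x | q x = 0}) = p'
  · exact Or.inl hpp
  refine Or.inr fun B hB B' hB' ↦ ?_
  have hout : (closure (W ⟨p₂, hp₂⟩))ᶜ ∈ 𝓝 (p' : M) :=
    isClosed_closure.isOpen_compl.mem_nhds fun hmem ↦
      hpp (Subtype.ext (hWZ ⟨p₂, hp₂⟩ _ hmem p'.2).symm)
  obtain ⟨r, hrB, hr0⟩ := ((hlim₂.eventually (eventually_mem_nhds_iff.2 hB)).and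
    (eventually_ge_atTop 0)).exists
  have hflow := (h.tendsto_flow hy (tendsto_const_nhds (x := r))).eventually hrB
  obtain ⟨a, ha, har, haB, haB', haout⟩ := (hS.and ((hts_large r).and (hflow.and
    ((hlt.eventually hB').and (hlt.eventually hout))))).exists
  have hend : φ (φ (φ a.1 a.2.1) r) (a.2.2 - a.2.1 - r) = φ a.1 a.2.2 := by
    rw [← h.add, ← h.add]; congr 1; ring
  refine ⟨_, haB, a.2.2 - a.2.1 - r, a.2.2 - a.2.1 - r, by linarith, le_rfl, by rwa [hend], ?_, ?_⟩
  · have h1 := h.drop_add a.1 (a.2.1 + r) (a.2.2 - a.2.1 - r)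
    rw [show a.2.1 + r + (a.2.2 - a.2.1 - r) = a.2.2 by ring, h.add] at h1
    have h2 := h.drop_nonneg a.1 (t := a.2.1 + r) (by linarith [ha.1])
    linarith [ha.2.2.1]
  · rw [hend]
    exact fun hmem ↦ haout (subset_closure hmem)

/-- In the absence of cycles of heteroclinic trajectories, each zero `p` has a neighborhood `B p`
such that trajectory pieces of dissipation at most `D` with both ends in `B p` stay in `V p`. -/
theorem exists_nhds_no_return [T2Space M] [LocallyCompactSpace M] (h : IsDissipative φ q)
    (hZ : {x | q x = 0}.Finite) {K : Set M} (hK : IsCompact K) {c : ℝ} (hc : 0 < c)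
    (hq : ∀ x ∉ K, c ≤ q x) (hacyc : ∀ p, ¬ Relation.TransGen (Heteroclinic φ q) p p) (D : ℝ)
    (V : {x | q x = 0} → Set M) (hV : ∀ p : {x | q x = 0}, V p ∈ 𝓝 (p : M))
    (p : {x | q x = 0}) :
    ∃ B, IsOpen B ∧ (p : M) ∈ B ∧ ∀ x ∈ B, ∀ s t, 0 ≤ s → s ≤ t → φ x t ∈ B →
      drop φ q x t ≤ D → φ x s ∈ V p := by
  have hW : ∀ p : {x | q x = 0}, ∃ W, IsOpen W ∧ (p : M) ∈ W ∧ IsCompact (closure W) ∧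
      (∀ z ∈ closure W, q z = 0 → z = p) ∧ W ⊆ V p := by
    intro p
    have hN : V p ∩ ({x | q x = 0} \ {(p : M)})ᶜ ∈ 𝓝 (p : M) :=
      inter_mem (hV p) ((hZ.subset sdiff_subset).isClosed.isOpen_compl.mem_nhds (by simp))
    obtain ⟨L, hL, hLN, hLc⟩ := local_compact_nhds hN
    have hcl : closure (interior L) ⊆ L := hLc.isClosed.closure_interior_subset
    refine ⟨interior L, isOpen_interior, mem_interior_iff_mem_nhds.2 hL,
      hLc.of_isClosed_subset isClosed_closure hcl, fun z hz hqz ↦ ?_,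
      fun z hz ↦ (hLN (interior_subset hz)).1⟩
    by_contra hne
    exact (hLN (hcl hz)).2 ⟨hqz, hne⟩
  choose W hWo hWp hWc hWZ hWV using hW
  -- Acyclicity on a finite set makes the chain relation well-founded.
  have hwf : WellFounded fun a b ↦ Relation.TransGen (Heteroclinic φ q) b a := by
    have : Finite {x | q x = 0} := hZ
    have : IsTrans _ fun a b ↦ Relation.TransGen (Heteroclinic φ q) b a :=
      ⟨fun _ _ _ h1 h2 ↦ h2.trans h1⟩
    have : Std.Irrefl fun a b ↦ Relation.TransGen (Heteroclinic φ q) b a := ⟨hacyc⟩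
    exact Finite.wellFounded_of_trans_of_irrefl _
  have hchain : ∀ a b : {x | q x = 0}, Escapes φ q D (W a) a b →
      Relation.TransGen (Heteroclinic φ q) a b := by
    intro a
    induction a using hwf.induction with
    | _ a ih =>
      intro b hab
      obtain ⟨a₂, h1, h2⟩ := h.heteroclinic_of_escapes hZ hK hc hq W hWo hWp hWc hWZ hab
      rcases h2 with rfl | h2
      · exact .single h1
      · exact (Relation.TransGen.single h1).trans (ih a₂ (.single h1) b h2)
  have hno : ¬ Escapes φ q D (W p) p p := fun hesc ↦ hacyc p (hchain p p hesc)
  simp only [Escapes] at hno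
  push Not at hno
  obtain ⟨B, hB, B', hB', hBB⟩ := hno
  refine ⟨interior (B ∩ B'), isOpen_interior,
    mem_interior_iff_mem_nhds.2 (inter_mem hB hB'), fun x hx s t hs hst ht hD ↦ hWV p ?_⟩
  exact hBB x (interior_subset hx).1 s t hs hst (interior_subset ht).2 hD

end IsDissipative

end Dynamics

/-! ### Null-homotopic neighborhoods and smooth choices of times -/

section Cover

/-- Every point has a neighborhood that is null-homotopic in the manifold: a ball in a chart. -/
theorem exists_nhds_nullhomotopic (E : Type*) [NormedAddCommGroup E] [NormedSpace ℝ E]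
    {M : Type*} [TopologicalSpace M] [ChartedSpace E M] (p : M) : ∃ W ∈ 𝓝 p,
    (ContinuousMap.mk (Subtype.val : W → M) continuous_subtype_val).Nullhomotopic := by
  set e := extChartAt 𝓘(ℝ, E) p
  obtain ⟨r, hr, hball⟩ := Metric.mem_nhds_iff.1 (extChartAt_target_mem_nhds (I := 𝓘(ℝ, E)) p)
  refine ⟨e.source ∩ e ⁻¹' Metric.ball (e p) r, inter_mem (extChartAt_source_mem_nhds p)
    ((continuousAt_extChartAt p).preimage_mem_nhds (Metric.ball_mem_nhds _ hr)), ?_⟩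
  have : ContractibleSpace (Metric.ball (e p) r) :=
    (convex_ball _ _).contractibleSpace ⟨_, Metric.mem_ball_self hr⟩
  let f : C(↥(e.source ∩ e ⁻¹' Metric.ball (e p) r), Metric.ball (e p) r) :=
    ⟨fun x ↦ ⟨e x, x.2.2⟩, Continuous.subtype_mk (continuousOn_iff_continuous_domRestrict.1
      ((continuousOn_extChartAt p).mono inter_subset_left)) _⟩
  let k : C(Metric.ball (e p) r, M) :=
    ⟨fun y ↦ e.symm y, continuousOn_iff_continuous_domRestrict.1
      ((continuousOn_extChartAt_symm p).mono hball)⟩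
  have hnull := ((id_nullhomotopic (Metric.ball (e p) r)).comp_left f).comp_right k
  convert hnull using 1
  ext x
  exact (e.left_inv x.2.1).symm

variable {E : Type*} [NormedAddCommGroup E] [NormedSpace ℝ E]
  {M : Type*} [TopologicalSpace M] [ChartedSpace E M]

/-- If for each point there is a time satisfying an open condition, then between two such times
there is one that depends smoothly on the point. -/
theorem exists_contMDiffOn_time [FiniteDimensional ℝ E] [T2Space M] [SecondCountableTopology M]
    [IsManifold 𝓘(ℝ, E) ∞ M] {S : Set (M × ℝ)} (hS : IsOpen S) {U : Set M} (hU : IsOpen U)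
    (hSU : ∀ x ∈ U, ∃ t, (x, t) ∈ S) :
    ∃ τ : M → ℝ, ContMDiffOn 𝓘(ℝ, E) 𝓘(ℝ, ℝ) ∞ τ U ∧
      ∀ x ∈ U, ∃ t₁ t₂, (x, t₁) ∈ S ∧ (x, t₂) ∈ S ∧ t₁ ≤ τ x ∧ τ x ≤ t₂ := by
  classical
  have : LocallyCompactSpace M := Manifold.locallyCompact_of_finiteDimensional 𝓘(ℝ, E)
  let O : TopologicalSpace.Opens M := ⟨U, hU⟩
  have : LocallyCompactSpace O := hU.locallyCompactSpace
  obtain ⟨f, hf⟩ := exists_contMDiffMap_forall_mem_convex_of_local_const (n := ⊤) 𝓘(ℝ, E)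
    (M := O) (t := fun x ↦ {t : ℝ | ∃ t₁ t₂, ((x : M), t₁) ∈ S ∧ ((x : M), t₂) ∈ S ∧
      t₁ ≤ t ∧ t ≤ t₂})
    (fun x ↦ by
      refine OrdConnected.convex ⟨?_⟩
      rintro a ⟨a₁, -, ha₁, -, haa, -⟩ b ⟨-, b₂, -, hb₂, -, hbb⟩ t ht
      exact ⟨a₁, b₂, ha₁, hb₂, haa.trans ht.1, ht.2.trans hbb⟩)
    (fun x ↦ by
      obtain ⟨t, ht⟩ := hSU x x.2
      refine ⟨t, ?_⟩
      have hc : Continuous fun y : O ↦ ((y : M), t) := by fun_prop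
      filter_upwards [hc.continuousAt.eventually_mem (hS.mem_nhds ht)] with y hy
      exact ⟨t, t, hy, hy, le_rfl, le_rfl⟩)
  let τ : M → ℝ := fun x ↦ if hx : x ∈ U then f ⟨x, hx⟩ else 0
  have hτ : ∀ x : O, τ x = f x := fun x ↦ dif_pos x.2
  refine ⟨τ, fun x hx ↦ ?_, fun x hx ↦ ?_⟩
  · refine ContMDiffAt.contMDiffWithinAt ?_
    have h1 : ContMDiffAt 𝓘(ℝ, E) 𝓘(ℝ, ℝ) ∞ (fun y : O ↦ τ y) ⟨x, hx⟩ := by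
      simp_rw [hτ]; exact f.contMDiff _
    exact contMDiffAt_subtype_iff.1 h1
  · have := hf ⟨x, hx⟩
    rw [← hτ] at this
    exact this

/-- A set that a flow carries into a null-homotopic set, after continuously varying times, is
null-homotopic. -/
theorem IsDissipative.nullhomotopic {φ : M → ℝ → M} {q : M → ℝ} (h : IsDissipative φ q)
    {V W : Set M} {τ : M → ℝ} (hτ : ContinuousOn τ V) (hVW : ∀ x ∈ V, φ x (τ x) ∈ W)
    (hW : (ContinuousMap.mk (Subtype.val : W → M) continuous_subtype_val).Nullhomotopic) :
    (ContinuousMap.mk (Subtype.val : V → M) continuous_subtype_val).Nullhomotopic := by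
  have hτ' : Continuous fun x : V ↦ τ x := continuousOn_iff_continuous_domRestrict.1 hτ
  let f : C(V, W) := ⟨fun x ↦ ⟨φ x (τ x), hVW x x.2⟩,
    (h.continuous_flow.comp (continuous_subtype_val.prodMk hτ')).subtype_mk _⟩
  obtain ⟨y, hy⟩ := hW.comp_left f
  refine ⟨y, ContinuousMap.Homotopic.trans ⟨?_⟩ hy⟩
  refine ⟨⟨fun a ↦ φ a.2 (a.1 * τ a.2), ?_⟩, fun x ↦ ?_, fun x ↦ ?_⟩
  · refine h.continuous_flow.comp
      (Continuous.prodMk (by fun_prop) (Continuous.mul (by fun_prop) ?_))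
    exact hτ'.comp continuous_snd
  · simp [h.zero]
  · simp [f]

end Cover

/-! ### The gradient flow -/

section GradientFlow

variable {E : Type*} [NormedAddCommGroup E] [NormedSpace ℝ E] [FiniteDimensional ℝ E]
  {M : Type*} [TopologicalSpace M] [ChartedSpace E M] [IsManifold 𝓘(ℝ, E) ∞ M]
  {g : Metric E M} {η : ClosedOneForm E M} {φ : M → ℝ → M}

theorem exists_isFlowOf_neg_grad (hgrad : IsCompleteField (grad g η)) :
    ∃ φ : M → ℝ → M, IsFlowOf φ (fun x ↦ -grad g η x) := by
  choose γ hγ0 hγ using hgrad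
  refine ⟨fun x t ↦ γ x (t * -1), fun x ↦ by simp [hγ0], fun x ↦ ?_⟩
  have := (hγ x).comp_mul (-1)
  have he : ((-1 : ℝ) • grad g η) = fun x ↦ -grad g η x := by
    ext x; simp
  rw [he] at this
  exact this

theorem IsFlowOf.isDissipative [T2Space M] (h : IsFlowOf φ (fun x ↦ -grad g η x)) :
    IsDissipative φ (gradRate g η) where
  continuous_flow := (h.contMDiff (contMDiff_neg_grad g η)).continuous
  zero := h.zero
  add := h.add (contMDiff_neg_grad g η)
  continuous_rate := continuous_gradRate g η
  nonneg := gradRate_nonneg g η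
  fixed x hx t := by
    have h0 : -grad g η x = 0 := by simp [grad_eq_zero_of_gradRate g η hx]
    have := isMIntegralCurve_Ioo_eq_of_contMDiff_boundaryless (t₀ := 0)
      ((contMDiff_neg_grad g η).of_le (by simp)) (h.integralCurve x)
      (isMIntegralCurve_const (I := 𝓘(ℝ, E)) h0) (h.zero x)
    exact congrFun this t

/-- The integral of the form along the gradient trajectory of `x` up to time `τ`, parametrized by
`[0, 1]`. -/
theorem IsFlowOf.integral_eq_neg_drop (h : IsFlowOf φ (fun x ↦ -grad g η x)) (x : M) (τ : ℝ) :
    η.integral (fun s ↦ φ x (s * τ)) = -drop φ (gradRate g η) x τ := by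
  have hcurve : IsMIntegralCurve (I := 𝓘(ℝ, E)) (fun s ↦ φ x (s * τ))
      (τ • fun x ↦ -grad g η x) := (h.integralCurve x).comp_mul τ
  have hder : ∀ t ∈ uIcc (0 : ℝ) 1, η.toFun (φ x (t * τ))
      (mfderivWithin 𝓘(ℝ, ℝ) 𝓘(ℝ, E) (fun s ↦ φ x (s * τ)) (Icc 0 1) t (1 : ℝ)) =
      -(τ * gradRate g η (φ x (t * τ))) := by
    intro t ht
    rw [uIcc_of_le zero_le_one] at ht
    have h1 := (hcurve t).hasMFDerivWithinAt (s := Icc 0 1) |>.mfderivWithin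
      (uniqueMDiffWithinAt_iff_uniqueDiffWithinAt.2 (uniqueDiffOn_Icc zero_lt_one t ht))
    rw [h1]
    change η.toFun (φ x (t * τ)) ((1 : ℝ) • (τ • -grad g η (φ x (t * τ)))) = _
    rw [one_smul, map_smul, map_neg, smul_eq_mul, mul_neg]
    rfl
  rw [ClosedOneForm.integral, intervalIntegral.integral_congr hder, intervalIntegral.integral_neg,
    intervalIntegral.integral_const_mul, ← smul_eq_mul,
    intervalIntegral.smul_integral_comp_mul_right (fun s ↦ gradRate g η (φ x s))]
  simp [drop]

/-- A closed chain of heteroclinic trajectories is a homoclinic cycle. -/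
theorem IsFlowOf.hasHomoclinicCycle [T2Space M] (h : IsFlowOf φ (fun x ↦ -grad g η x))
    {p : {x | gradRate g η x = 0}}
    (hp : Relation.TransGen (Heteroclinic φ (gradRate g η)) p p) :
    GradientFlowHasHomoclinicCycle g η := by
  have key : ∀ a b, Relation.TransGen (Heteroclinic φ (gradRate g η)) a b →
      ∃ (m : ℕ) (P : ℕ → {x | gradRate g η x = 0}), P 0 = a ∧ P (m + 1) = b ∧
        ∀ i ≤ m, Heteroclinic φ (gradRate g η) (P i) (P (i + 1)) := by
    intro a b hab
    induction hab using Relation.TransGen.head_induction_on with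
    | @single a h1 =>
      refine ⟨0, fun i ↦ if i = 0 then a else b, by simp, by simp, fun i hi ↦ ?_⟩
      obtain rfl : i = 0 := by omega
      simpa using h1
    | @head a c h1 _ ih =>
      obtain ⟨m, P, h0, hm, hP⟩ := ih
      refine ⟨m + 1, fun i ↦ Nat.casesOn i a P, rfl, hm, fun i hi ↦ ?_⟩
      cases i with
      | zero => rw [← h0] at h1; exact h1
      | succ i => exact hP i (by omega)
  obtain ⟨m, P, h0, hm, hP⟩ := key p p hp
  have : Nonempty M := ⟨p⟩
  choose! y hy hbot htop using hP
  refine ⟨m, fun i ↦ P i, fun i ↦ φ (y i), fun i ↦ ?_, fun i ↦ ⟨h.integralCurve _, ?_, ?_, ?_⟩⟩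
  · have := grad_eq_zero_of_gradRate g η (P i).2
    simp [this]
  · by_contra! hconst
    have h1 : Tendsto (φ (y i)) atTop (𝓝 (y i)) := by
      have : φ (y i) = fun _ ↦ y i := by
        ext t; rw [hconst t 0, h.zero]
      rw [this]; exact tendsto_const_nhds
    have h2 := tendsto_nhds_unique h1 (htop i (by omega))
    exact hy i (by omega) (by rw [h2]; exact (P (i + 1)).2)
  · exact hbot i (by omega)
  · have hnext : P ((i + 1 : Fin (m + 1)) : ℕ) = P (i + 1) := by
      rcases Nat.lt_or_ge i m with hi | hi
      · rw [Fin.val_add_one_of_lt (Fin.lt_def.2 (by simpa using hi))]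
      · obtain rfl : i = Fin.last m := Fin.ext (by simp; omega)
        simp [h0, hm]
    change Tendsto _ _ (𝓝 (P ((i + 1 : Fin (m + 1)) : ℕ) : M))
    rw [hnext]
    exact htop i (by omega)

/-- Without homoclinic cycles there is a cover as in the definition of the category, with one
null-homotopic set for each zero. -/
theorem IsFlowOf.hasCover [T2Space M] [SecondCountableTopology M]
    (h : IsFlowOf φ (fun x ↦ -grad g η x)) (hZ : η.zeros.Finite) {K : Set M} (hK : IsCompact K)
    {c : ℝ} (hc : 0 < c) (hq : ∀ x ∉ K, c ≤ gradRate g η x)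
    (hcyc : ¬ GradientFlowHasHomoclinicCycle g η) (N : ℕ) : η.HasCover η.zeros.ncard N := by
  have : LocallyCompactSpace M := Manifold.locallyCompact_of_finiteDimensional 𝓘(ℝ, E)
  have hd := h.isDissipative
  rw [← setOf_gradRate_eq_zero g η] at hZ ⊢
  set q := gradRate g η with hqdef
  have hacyc : ∀ p, ¬ Relation.TransGen (Heteroclinic φ q) p p :=
    fun p hp ↦ hcyc (h.hasHomoclinicCycle hp)
  choose W hW hWnull using fun p : {x | q x = 0} ↦ exists_nhds_nullhomotopic E (p : M)
  choose B hBo hBp hB using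
    hd.exists_nhds_no_return hZ hK hc hq hacyc (N + 1) W hW
  -- Times at which more than `N` is dissipated, and times of visits to `B p` before `N + 1` is.
  let S : Set (M × ℝ) := {a | 0 < a.2 ∧ (N : ℝ) < drop φ q a.1 a.2}
  let T (p : {x | q x = 0}) : Set (M × ℝ) :=
    {a | 0 < a.2 ∧ φ a.1 a.2 ∈ B p ∧ drop φ q a.1 a.2 < N + 1}
  have hS : IsOpen S := (isOpen_lt continuous_const continuous_snd).inter
    (isOpen_lt continuous_const hd.continuous_drop)
  have hT : ∀ p, IsOpen (T p) := fun p ↦ (isOpen_lt continuous_const continuous_snd).inter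
    (((hBo p).preimage hd.continuous_flow).inter (isOpen_lt hd.continuous_drop continuous_const))
  have hfst : ∀ {A : Set (M × ℝ)}, ∀ x ∈ Prod.fst '' A, ∃ t, (x, t) ∈ A := by
    rintro A _ ⟨⟨x, t⟩, hx, rfl⟩; exact ⟨t, hx⟩
  have hSo := isOpenMap_fst _ hS
  have hTo := fun p ↦ isOpenMap_fst _ (hT p)
  obtain ⟨τ, hτ, hτS⟩ := exists_contMDiffOn_time (E := E) hS hSo hfst
  choose σ hσ hσT using fun p ↦ exists_contMDiffOn_time (E := E) (hT p) (hTo p) hfst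
  have : Finite {x | q x = 0} := hZ
  let ι : Fin ({x | q x = 0}.ncard) ≃ {x | q x = 0} := (Finite.equivFin _).symm
  refine ⟨Prod.fst '' S, fun i ↦ Prod.fst '' T (ι i), hSo, fun i ↦ hTo _, ?_, fun i ↦ ?_,
    fun x s ↦ φ x (s * τ x), ?_, fun x _ ↦ by simp [h.zero], fun x hx ↦ ?_⟩
  · rw [eq_univ_iff_forall]
    intro x
    by_cases hx : ∃ t, 0 < t ∧ (N : ℝ) < drop φ q x t
    · obtain ⟨t, ht⟩ := hx
      exact Or.inl ⟨(x, t), ht, rfl⟩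
    · push Not at hx
      have hD : ∀ t, 0 ≤ t → drop φ q x t ≤ N := fun t ht ↦ by
        rcases ht.eq_or_lt with rfl | ht
        · simp [drop]
        · exact hx t ht
      obtain ⟨p, hp, hlim⟩ := hd.exists_tendsto_atTop hZ hK hc hq hD
      obtain ⟨t, htB, ht0⟩ := ((hlim.eventually ((hBo ⟨p, hp⟩).mem_nhds (hBp ⟨p, hp⟩))).and
        (eventually_gt_atTop 0)).exists
      refine Or.inr (mem_iUnion.2 ⟨ι.symm ⟨p, hp⟩, (x, t), ?_, rfl⟩)
      rw [Equiv.apply_symm_apply]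
      exact ⟨ht0, htB, (hD t ht0.le).trans_lt (lt_add_one _)⟩
  · refine hd.nullhomotopic (W := W (ι i)) (hσ (ι i)).continuousOn (fun x hx ↦ ?_) (hWnull _)
    obtain ⟨t₁, t₂, h1, h2, hle1, hle2⟩ := hσT (ι i) x hx
    have hend : φ (φ x t₁) (t₂ - t₁) = φ x t₂ := by rw [← hd.add, add_sub_cancel]
    have := hB (ι i) (φ x t₁) h1.2.1 (σ (ι i) x - t₁) (t₂ - t₁) (by linarith) (by linarith)
      (by rw [hend]; exact h2.2.1) (by
        have h3 := hd.drop_add x t₁ (t₂ - t₁)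
        rw [add_sub_cancel] at h3
        linarith [hd.drop_nonneg x h1.1.le, h2.2.2])
    rwa [← hd.add, add_sub_cancel] at this
  · refine (h.contMDiff (contMDiff_neg_grad g η)).comp_contMDiffOn
      (f := fun a : M × ℝ ↦ (a.1, a.2 * τ a.1)) (contMDiffOn_fst.prodMk ?_)
    exact contMDiffOn_snd.mul (hτ.comp contMDiffOn_fst fun a ha ↦ ha.1)
  · obtain ⟨t₁, -, h1, -, hle, -⟩ := hτS x hx
    rw [h.integral_eq_neg_drop]
    have := hd.drop_mono x hle
    linarith [h1.2]

/-- A gradient flow without homoclinic cycles would make the category at most the number of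
zeros. -/
theorem gradientFlowHasHomoclinicCycle [T2Space M] [SecondCountableTopology M]
    (hzeros : η.zeros.encard < η.cat) (hgrad : IsCompleteField (grad g η)) {c : ℝ} (hc : 0 < c)
    {U : Set M} (hUc : IsCompact (closure U))
    (hlower : ∀ x ∉ U, c ≤ Metric.norm g (grad g η x)) : GradientFlowHasHomoclinicCycle g η := by
  by_contra hcyc
  obtain ⟨φ, hφ⟩ := exists_isFlowOf_neg_grad hgrad
  have hZ : η.zeros.Finite := encard_lt_top_iff.1 (hzeros.trans_le le_top)
  have hcover := hφ.hasCover hZ hUc (c := c ^ 2) (by positivity)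
    (fun x hx ↦ by
      rw [← norm_grad_sq]
      have := hlower x fun hxU ↦ hx (subset_closure hxU)
      gcongr) hcyc
  have hcat : η.cat ≤ η.zeros.ncard := iInf₂_le _ fun N _ ↦ hcover N
  rw [hZ.cast_ncard_eq] at hcat
  exact absurd hzeros (not_lt.2 hcat)

end GradientFlow

end Homoclinic

end

theorem mainTheorem2
    {E : Type*} [NormedAddCommGroup E] [NormedSpace ℝ E] [FiniteDimensional ℝ E]
    {M : Type*} [TopologicalSpace M] [T2Space M] [SecondCountableTopology M]
    [ChartedSpace E M] [IsManifold 𝓘(ℝ, E) ∞ M]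
    (g : Homoclinic.Metric E M) (η : Homoclinic.ClosedOneForm E M)
    (hg : Homoclinic.Metric.IsComplete g)
    (hzeros : η.zeros.encard < η.cat)
    (hgrad : Homoclinic.IsCompleteField (Homoclinic.grad g η))
    (c : ℝ) (hc : 0 < c) (U : Set M) (hU : U ∈ 𝓝ˢ η.zeros) (hUc : IsCompact (closure U))
    (hlower : ∀ x ∉ U, c ≤ Homoclinic.Metric.norm g (Homoclinic.grad g η x)) :
    Homoclinic.GradientFlowHasHomoclinicCycle g η ∧
    ∀ (g' : Homoclinic.Metric E M) (C : ℝ), 1 ≤ C →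
      Homoclinic.Metric.IsComplete g' →
      Homoclinic.IsCompleteField (Homoclinic.grad g' η) →
      (∀ (x : M) (v : TangentSpace 𝓘(ℝ, E) x),
        g.inner x v v / C ≤ g'.inner x v v ∧ g'.inner x v v ≤ C * g.inner x v v) →
      (∀ x ∉ U, c / C ≤ Homoclinic.Metric.norm g' (Homoclinic.grad g' η x)) ∧
      Homoclinic.GradientFlowHasHomoclinicCycle g' η := by
  refine ⟨Homoclinic.gradientFlowHasHomoclinicCycle hzeros hgrad hc hUc hlower, ?_⟩
  intro g' C hC _ hgrad' hle
  have hlower' : ∀ x ∉ U, c / C ≤ Homoclinic.Metric.norm g' (Homoclinic.grad g' η x) :=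
    fun x hx ↦ Homoclinic.le_norm_grad_of_le g η g' hc hC (fun v ↦ (hle x v).2) (hlower x hx)
  exact ⟨hlower', Homoclinic.gradientFlowHasHomoclinicCycle hzeros hgrad'
    (div_pos hc (lt_of_lt_of_le one_pos hC)) hUc hlower'⟩
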